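/- Let $N,L\ge 1$, $n\in\mathbb Z$, and write $\doteq$ for equality up to a phase in $U(1)$. **Setting.** On a periodic chain of $L$ sites with local space $\mathbb C^d$, a $\mathbb Z_N$ *charge and dipole symmetry* consists of on-site unitaries $U_{q,j},U_{d,j}$ ($j\in\mathbb Z$), $L$-periodic in $j$, with $U_{q,j}^N\doteq 1$, $U_{d,j}^N\doteq 1$, and, with $\mathcal T$ the one-site translation, $\mathcal T U_{q,j}\mathcal T^\dagger=U_{q,j-1}$, $\mathcal T U_{d,j}\mathcal T^\dagger=U_{d,j-1}U_{q,j-1}$; that is, as $d\times d$ matrices, $U_{q,j}=U_{q,j-1}$ and $U_{d,j}=U_{d,j-1}U_{q,j-1}$. The on-site operators are said to *commute up to $e^{2\pi i n/N}$* if $$U_{q,j}U_{d,j}=e^{2\pi i n/N}\,U_{d,j}U_{q,j}\quad\text{for all } j.$$ An MPS tensor $A=(A^s)_{s=1}^d$ of $\chi\times\chi$ matrices gives the states $|\psi_M\rangle=\sum_{s_1,\dots,s_M}\mathrm{Tr}(A^{s_1}\cdots A^{s_M})|s_1\cdots s_M\rangle$. It is *injective* if its transfer matrix $X\mapsto\sum_s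 A^sX(A^s)^\dagger$ has a unique dominant eigenvalue $r>0$ (every eigenvalue $\mu$ with $|\mu|\ge r$ equals $r$), with one-dimensional eigenspace, and the corresponding right and left eigenvectors can be chosen positive definite; it is *left-canonical* if $\sum_s (A^s)^\dagger A^s=1$. It is *symmetric* under $L$-periodic on-site unitaries $U_j$ if $\bigotimes_{j=1}^{kL}U_j|\psi_{kL}\rangle\doteq|\psi_{kL}\rangle$ for every $k\ge1$. Put $(U\cdot A)^s=\sum_t U_{st}A^t$. **Claims.** 1. (Push-through.) If $A$ is injective, left-canonical and symmetric under both $U_q$ and $U_d$ of a $\mathbb Z_N$ charge and dipole symmetry, then there are unitary $\chi\times\chi$ matrices $v_q$ and $v_{d,j}$ ($j\in\mathbb Z$) with $U_{q,j}\cdot A\doteq v_q^\dagger A v_q$, $U_{d,j}\cdot A\doteq v_{d,j-1}^\dagger A v_{d,j}$ and $v_{d,j+L}\doteq v_{d,j}$ for all $j$. 2. (Site-independence.) For every $\mathbb Z_N$ charge and dipole symmetry, every injective $A$ and all unitaries $v_q,v_{d,j}$ satisfying the two push-through relations of 1 for all $j$, one has $v_{d,j}\doteq v_{d,j-1}v_q$,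 and the commutator $v_qv_{d,j}v_q^{-1}v_{d,j}^{-1}$ does not depend on $j$. 3. (Required change.) Let $U_{q,j},U_{d,j}$ be on-site unitaries with $U_{q,j}^N\doteq1\doteq U_{d,j}^N$ that commute up to $e^{2\pi i n/N}$, and let $A$ be injective and $v_q,v_{d,j}$ unitaries satisfying the two push-through relations of 1 for all $j$. Then there are integers $k_j$ with $v_qv_{d,j}v_q^{-1}v_{d,j}^{-1}=e^{2\pi i k_j/N}\,1$ and $k_j\equiv k_{j-1}+n\pmod N$ for all $j$. (The phase labels the projective class on the bond $j$.) 4. (LSM constraint.) If a $\mathbb Z_N$ charge and dipole symmetry commutes on site up to $e^{2\pi i n/N}$ and $n\not\equiv0\pmod N$, then no injective MPS tensor, of any bond dimension, is symmetric under both $U_q$ and $U_d$. 5. (Example.) Let $N\mid L$, $d=N$, $X|s\rangle=|s+1 \bmod N\rangle$ and $Z|s\rangle=e^{2\pi i s/N}|s\rangle$. Then $U_{q,j}=X$, $U_{d,j}=Z^{-n}X^j$ form a $\mathbb Z_N$ charge and dipole symmetry that commutes on site up to $e^{2\pi i n/N}$; so for $n\not\equiv 0\pmod N$ there is no injective MPS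 tensor symmetric under both $\mathcal U_q=\bigotimes_jX_j$ and $\mathcal U_d=\bigotimes_jZ_j^{-n}X_j^j$. -/

import Mathlib

namespace DipoleLSM

noncomputable section

open Matrix Complex
open scoped ComplexOrder

/-- Equality up to a phase (written `≐` in physics): `x = z y` for some complex `z` with
`|z| = 1`. -/
def EqPhase {M : Type*} [SMul ℂ M] (x y : M) : Prop :=
  ∃ z : ℂ, ‖z‖ = 1 ∧ x = z • y

/-- A translation invariant MPS tensor with physical dimension `d` and bond dimension `χ`:
one `χ × χ` matrix `A s` for each physical index `s`. -/
abbrev Tensor (d χ : ℕ) := Fin d → Matrix (Fin χ) (Fin χ) ℂ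

/-- Unitary operators on a `d`-dimensional space. -/
abbrev Unitary (d : ℕ) := Matrix.unitaryGroup (Fin d) ℂ

/-- The transfer matrix `∑ₛ Aˢ ⊗ (Aˢ)*`, acting on bond matrices (right action):
`X ↦ ∑ₛ Aˢ X (Aˢ)†`. -/
def transfer {d χ : ℕ} (A : Tensor d χ) : Module.End ℂ (Matrix (Fin χ) (Fin χ) ℂ) where
  toFun X := ∑ s, A s * X * (A s)ᴴ
  map_add' X Y := by simp only [Matrix.mul_add, Matrix.add_mul, Finset.sum_add_distrib]
  map_smul' c X := by
    simp only [Matrix.mul_smul, Matrix.smul_mul, Finset.smul_sum, RingHom.id_apply]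

/-- The transfer matrix acting from the other side: `X ↦ ∑ₛ (Aˢ)† X Aˢ`. -/
def transferLeft {d χ : ℕ} (A : Tensor d χ) : Module.End ℂ (Matrix (Fin χ) (Fin χ) ℂ) :=
  transfer fun s => (A s)ᴴ

/-- An injective MPS tensor: the transfer matrix has a unique dominant eigenvalue `r > 0`, which
is nondegenerate, and the dominant right and left eigenvectors are positive definite.
(Eigenvectors are nonzero, so the bond dimension is positive.) No choice of gauge or of
normalization is made here. -/
def IsInjective {d χ : ℕ} (A : Tensor d χ) : Prop :=
  ∃ (r : ℝ) (ρ Λ : Matrix (Fin χ) (Fin χ) ℂ), 0 < r ∧ ρ.PosDef ∧ Λ.PosDef ∧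
    (transfer A).HasEigenvector (r : ℂ) ρ ∧
    (transferLeft A).HasEigenvector (r : ℂ) Λ ∧
    ∀ (μ : ℂ) (X : Matrix (Fin χ) (Fin χ) ℂ), (transfer A).HasEigenvector μ X → r ≤ ‖μ‖ →
      μ = (r : ℂ) ∧ ∃ c : ℂ, X = c • ρ

/-- Left-canonical gauge: `∑ₛ (Aˢ)† Aˢ = 1`. For an injective tensor the dominant eigenvalue of
the transfer matrix is then `1`, with left eigenvector the identity. -/
def IsLeftCanonical {d χ : ℕ} (A : Tensor d χ) : Prop :=
  ∑ s, (A s)ᴴ * A s = 1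

/-- The periodic MPS on `M` sites: the vector with the components `Tr (A^{s₁} ⋯ A^{s_M})`. -/
def state {d χ : ℕ} (A : Tensor d χ) (M : ℕ) : (Fin M → Fin d) → ℂ :=
  fun s => (List.ofFn fun i => A (s i)).prod.trace

/-- The operator `⨂_{j=1}^M U_j` on `M` sites. The position `i = 0, …, M - 1` carries the
site label `j = i + 1`. -/
def globalOp {d : ℕ} (U : ℤ → Unitary d) (M : ℕ) :
    Matrix (Fin M → Fin d) (Fin M → Fin d) ℂ :=
  Matrix.of fun s t => ∏ i : Fin M, (U ((i : ℤ) + 1) : Matrix (Fin d) (Fin d) ℂ) (s i) (t i)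

/-- The MPS is symmetric under the on-site operators `U_j` (`L`-periodic in `j`): for each
`k ≥ 1`, on the chain made of `k` copies of the `L`-site unit cell the state is invariant up to
a phase under `⨂_{j=1}^{kL} U_j`, the `k`-fold periodic extension of `⨂_{j=1}^L U_j`. -/
def IsSymmetric {d χ : ℕ} (L : ℕ) (U : ℤ → Unitary d) (A : Tensor d χ) : Prop :=
  ∀ k : ℕ, 0 < k → EqPhase (globalOp U (k * L) *ᵥ state A (k * L)) (state A (k * L))

/-- Action of an operator on the physical leg: `(U · A)ˢ = ∑ₜ U_{st} Aᵗ`. -/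
def act {d χ : ℕ} (U : Unitary d) (A : Tensor d χ) : Tensor d χ :=
  fun s => ∑ t, (U : Matrix (Fin d) (Fin d) ℂ) s t • A t

/-- The push-through condition `U_j · A ≐ v_{j-1}† A v_j` at all sites `j`, where `v_j` is a
unitary on the bond between the sites `j` and `j + 1`. -/
def PushesThrough {d χ : ℕ} (A : Tensor d χ) (U : ℤ → Unitary d) (v : ℤ → Unitary χ) : Prop :=
  ∀ j : ℤ, EqPhase (act (U j) A)
    (fun s => (v (j - 1) : Matrix (Fin χ) (Fin χ) ℂ)ᴴ * A s * (v j : Matrix (Fin χ) (Fin χ) ℂ))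

/-- The commutator `v_q v_d v_q⁻¹ v_d⁻¹` of two bond unitaries. When it is a phase, it is the
coboundary-invariant phase `ω(q,d) ω(d,q)⁻¹` that labels the projective class on the bond. -/
def bondInvariant {χ : ℕ} (vq vd : Unitary χ) : Unitary χ :=
  vq * vd * vq⁻¹ * vd⁻¹

/-- On each site the operators generate a (possibly projective) representation of `ℤ_N`:
`U_j ^ N` is a phase. -/
def IsZN {d : ℕ} (N : ℕ) (U : ℤ → Unitary d) : Prop :=
  ∀ j : ℤ, EqPhase ((U j : Matrix (Fin d) (Fin d) ℂ) ^ N) 1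

/-- A `ℤ_N` charge and dipole symmetry on the periodic chain of `L` sites, with on-site charge
operators `U_{q,j}` and on-site dipole operators `U_{d,j}`. Conjugation by the one-site translation
carries an operator on the site `j` to the same matrix on the site `j - 1`, so that
`T U_{q,j} T† = U_{q,j-1}` and `T U_{d,j} T† = U_{d,j-1} U_{q,j-1}` read as below. -/
structure IsDipoleSymmetry {d : ℕ} (N L : ℕ) (Uq Ud : ℤ → Unitary d) : Prop where
  periodic_q : Function.Periodic Uq (L : ℤ)
  periodic_d : Function.Periodic Ud (L : ℤ)
  zn_q : IsZN N Uq
  zn_d : IsZN N Ud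
  translate_q : ∀ j : ℤ, Uq j = Uq (j - 1)
  translate_d : ∀ j : ℤ, Ud j = Ud (j - 1) * Uq (j - 1)

/-- The phase `exp (2 π i k / N)`. -/
def rootPhase (N : ℕ) (k : ℤ) : ℂ := Complex.exp (2 * Real.pi * Complex.I * k / N)

/-- On-site projective relation `U_{q,j} U_{d,j} = exp (2 π i n / N) U_{d,j} U_{q,j}`. -/
def OnSiteProjective {d : ℕ} (N : ℕ) (n : ℤ) (Uq Ud : ℤ → Unitary d) : Prop :=
  ∀ j : ℤ, (Uq j : Matrix (Fin d) (Fin d) ℂ) * (Ud j : Matrix (Fin d) (Fin d) ℂ) =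
    rootPhase N n • ((Ud j : Matrix (Fin d) (Fin d) ℂ) * (Uq j : Matrix (Fin d) (Fin d) ℂ))

/-- There is an injective MPS, of some bond dimension, that is symmetric under both the charge
and the dipole symmetry. -/
def HasSymmetricInjectiveMPS {d : ℕ} (L : ℕ) (Uq Ud : ℤ → Unitary d) : Prop :=
  ∃ (χ : ℕ) (A : Tensor d χ), IsInjective A ∧ IsSymmetric L Uq A ∧ IsSymmetric L Ud A

/-- The shift operator `X |s⟩ = |s + 1⟩` of an `N`-dimensional qudit (addition modulo `N`). -/
def shift (N : ℕ) [NeZero N] : Unitary N :=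
  ⟨Matrix.of fun s t => if s = t + 1 then 1 else 0, by
    rw [Matrix.mem_unitaryGroup_iff']
    ext s t
    simp [Matrix.mul_apply, Matrix.one_apply, Matrix.star_apply, apply_ite, eq_comm]⟩

/-- The clock operator `Z |s⟩ = exp (2 π i s / N) |s⟩` of an `N`-dimensional qudit. -/
def clock (N : ℕ) : Unitary N :=
  ⟨Matrix.diagonal fun s => rootPhase N (s : ℤ), by
    rw [Matrix.mem_unitaryGroup_iff', Matrix.star_eq_conjTranspose,
      Matrix.diagonal_conjTranspose, Matrix.diagonal_mul_diagonal, ← Matrix.diagonal_one]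
    congr 1
    funext s
    have h : ‖rootPhase N (s : ℤ)‖ = 1 := by
      have e : rootPhase N (s : ℤ) = Complex.exp (((2 * Real.pi * (s : ℕ) / N : ℝ) : ℂ) * I) := by
        unfold rootPhase
        congr 1
        push_cast
        ring
      rw [e, Complex.norm_exp_ofReal_mul_I]
    simp only [Pi.star_apply, RCLike.star_def]
    rw [mul_comm, Complex.mul_conj, Complex.normSq_eq_norm_sq, h]
    simp⟩

end

end DipoleLSM

/-! Everything rests on the spectral gap of the transfer matrix `E`: the powers of `E / r` converge
to the rank-one projection onto `ρ` along `Λ` (`Gapped.tendsto_functional`).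

Uniqueness. If two families of bond unitaries push through the same operators, their ratios `w j`
satisfy `w (j - 1) * A s = z • (A s * w j)`. Then `w j * ρ` is the image, under every power of `E /
r`, of a bounded matrix, so the gap forces it into the line of `ρ` and `w j` is a phase
(`IsInjective.eqPhase_one`). Consequently any identity up to phase between on-site operators passes
to the bonds. The dipole algebra gives `v_{d,j} ≐ v_{d,j-1} v_q`, so the bond commutator is constant
in `j`; the relation `U_q U_d = ω U_d U_q` instead makes it jump by `ω` at every site
(`PushesThrough.exists_commutator_phase`). For `ω ≠ 1` these two facts are incompatible, which is
the LSM constraint.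

Existence. Overlaps of periodic MPS are traces of products of mixed transfer matrices. Symmetry
makes the traces of powers of the unit-cell mixed matrix agree in modulus with those of `E ^ (k *
L)`, which tend to `1`; hence the former has an eigenvalue of modulus at least `1`. A mixed transfer
matrix contracts the `ρ`-weighted norm, with an explicit defect, so along this eigenvector every
defect vanishes and exact intertwiners appear (`IsSymmetric.exists_intertwiner`). The gap makes them
multiples of unitaries (`IsSymmetric.exists_unitary_intertwiner`). A tensor that is not
left-canonical is first brought to that gauge (`IsInjective.exists_gauge`). -/

namespace DipoleLSM

open Matrix Complex Filter Topology
open scoped ComplexOrder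

/-! ### Powers of endomorphisms with spectrum in the open unit disc -/

/-- The powers of an element of a complex Banach algebra whose spectrum lies in the open unit disc
tend to zero. -/
theorem tendsto_pow_zero_of_spectrum {B : Type*} [NormedRing B] [NormedAlgebra ℂ B]
    [CompleteSpace B] (a : B) (h : ∀ μ ∈ spectrum ℂ a, ‖μ‖ < 1) :
    Tendsto (fun k : ℕ => a ^ k) atTop (𝓝 0) := by
  rcases subsingleton_or_nontrivial B with hB | hB
  · exact tendsto_const_nhds.congr fun _ => Subsingleton.elim _ _
  have h1 : spectralRadius ℂ a < ((1 : NNReal) : ENNReal) :=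
    spectrum.spectralRadius_lt_of_forall_lt a fun k hk => by
      have := h k hk
      exact_mod_cast this
  obtain ⟨q, hq, hq1⟩ := ENNReal.lt_iff_exists_nnreal_btwn.1 h1
  have hq1' : (q : ℝ) < 1 := by exact_mod_cast hq1
  -- Gelfand's formula: eventually the `k`-th root of `‖a ^ k‖` is below `q < 1`, so `‖a ^ k‖ ≤ q ^
  -- k`.
  have ht := (spectrum.pow_nnnorm_pow_one_div_tendsto_nhds_spectralRadius a).eventually_lt_const hq
  rw [tendsto_zero_iff_norm_tendsto_zero]
  refine squeeze_zero' (Eventually.of_forall fun _ => norm_nonneg _) ?_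
    (tendsto_pow_atTop_nhds_zero_of_lt_one q.2 hq1')
  filter_upwards [ht, eventually_gt_atTop 0] with k hk hk0
  have hk' : (k : ℝ) ≠ 0 := by positivity
  have h2 : (‖a ^ k‖₊ : ENNReal) ≤ (q : ENNReal) ^ (k : ℝ) := by
    calc (‖a ^ k‖₊ : ENNReal) = ((‖a ^ k‖₊ : ENNReal) ^ (1 / k : ℝ)) ^ (k : ℝ) := by
          rw [← ENNReal.rpow_mul, one_div_mul_cancel hk', ENNReal.rpow_one]
      _ ≤ _ := ENNReal.rpow_le_rpow hk.le (by positivity)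
  rw [ENNReal.rpow_natCast] at h2
  exact_mod_cast h2

/-- The powers of an endomorphism of a finite-dimensional space whose eigenvalues lie in the open
unit disc tend to zero. -/
theorem tendsto_end_pow_zero {V : Type*} [NormedAddCommGroup V] [NormedSpace ℂ V]
    [FiniteDimensional ℂ V] (f : Module.End ℂ V)
    (h : ∀ (μ : ℂ) (x : V), x ≠ 0 → f x = μ • x → ‖μ‖ < 1) :
    Tendsto (fun k : ℕ => Module.End.toContinuousLinearMap V f ^ k) atTop (𝓝 0) := by
  have : CompleteSpace V := FiniteDimensional.complete ℂ V
  refine tendsto_pow_zero_of_spectrum _ fun μ hμ => ?_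
  rw [AlgEquiv.spectrum_eq, ← Module.End.hasEigenvalue_iff_mem_spectrum] at hμ
  obtain ⟨x, hx⟩ := hμ.exists_hasEigenvector
  exact h μ x hx.2 hx.apply_eq_smul

/-- Every linear functional tends to zero along the powers of an endomorphism whose eigenvalues lie
in the open unit disc. -/
theorem tendsto_functional_pow_zero {V : Type*} [NormedAddCommGroup V] [NormedSpace ℂ V]
    [FiniteDimensional ℂ V] (f : Module.End ℂ V)
    (h : ∀ (μ : ℂ) (x : V), x ≠ 0 → f x = μ • x → ‖μ‖ < 1)
    (φ : Module.End ℂ V →ₗ[ℂ] ℂ) :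
    Tendsto (fun k : ℕ => φ (f ^ k)) atTop (𝓝 0) := by
  let e := Module.End.toContinuousLinearMap (𝕜 := ℂ) V
  let ψ : (V →L[ℂ] V) →ₗ[ℂ] ℂ := φ ∘ₗ e.symm.toLinearMap
  have hψ : Continuous ψ := ψ.continuous_of_finiteDimensional
  have := (hψ.tendsto 0).comp (tendsto_end_pow_zero f h)
  rw [map_zero] at this
  refine this.congr fun k => ?_
  simp only [Function.comp_apply, ψ, LinearMap.comp_apply]
  rw [← map_pow]
  exact congrArg φ (e.symm_apply_apply _)

/-! ### The transfer matrix and its spectral projection -/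

section Transfer

variable {d χ : ℕ}

/-- Cyclicity of the trace: the two transfer matrices are transposes of each other for the pairing
`tr (X Y)`. -/
theorem trace_mul_transfer (A : Tensor d χ) (X Y : Matrix (Fin χ) (Fin χ) ℂ) :
    (X * transfer A Y).trace = (transferLeft A X * Y).trace := by
  simp only [transferLeft, transfer, LinearMap.coe_mk, AddHom.coe_mk, Matrix.mul_sum,
    Matrix.sum_mul, Matrix.trace_sum, conjTranspose_conjTranspose]
  refine Finset.sum_congr rfl fun s _ => ?_
  rw [← Matrix.mul_assoc, Matrix.trace_mul_comm]
  simp only [Matrix.mul_assoc]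

open scoped MatrixOrder in
theorem _root_.Matrix.PosDef.exists_eq_conjTranspose_mul_self {X : Matrix (Fin χ) (Fin χ) ℂ}
    (hX : X.PosDef) : ∃ S : Matrix (Fin χ) (Fin χ) ℂ, IsUnit S ∧ X = Sᴴ * S := by
  obtain ⟨S, hS⟩ := CStarAlgebra.nonneg_iff_eq_star_mul_self.1 hX.posSemidef.nonneg
  refine ⟨S, ?_, hS⟩
  have h := hX.isUnit
  rw [hS, Matrix.isUnit_iff_isUnit_det, Matrix.det_mul] at h
  exact (Matrix.isUnit_iff_isUnit_det _).2 (isUnit_of_mul_isUnit_right h)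

/-- With `X = S† S` the trace becomes that of the positive definite `S Y S†`. This makes the
denominator of `eigenProj` nonzero. -/
theorem trace_mul_pos [NeZero χ] {X Y : Matrix (Fin χ) (Fin χ) ℂ} (hX : X.PosDef) (hY : Y.PosDef) :
    0 < (X * Y).trace := by
  obtain ⟨S, hS, rfl⟩ := hX.exists_eq_conjTranspose_mul_self
  rw [Matrix.mul_assoc, Matrix.trace_mul_comm]
  exact (hY.mul_mul_conjTranspose_same (Matrix.vecMul_injective_of_isUnit hS)).trace_pos

/-- The spectral projection onto the right eigenvector `ρ`, when `Λ` is the left one. -/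
noncomputable def eigenProj (ρ Λ : Matrix (Fin χ) (Fin χ) ℂ) :
    Module.End ℂ (Matrix (Fin χ) (Fin χ) ℂ) where
  toFun Z := ((Λ * Z).trace / (Λ * ρ).trace) • ρ
  map_add' X Y := by rw [Matrix.mul_add, Matrix.trace_add, add_div, add_smul]
  map_smul' c X := by
    rw [Matrix.mul_smul, Matrix.trace_smul, smul_eq_mul, mul_div_assoc, mul_smul, RingHom.id_apply]

theorem eigenProj_apply (ρ Λ Z : Matrix (Fin χ) (Fin χ) ℂ) :
    eigenProj ρ Λ Z = ((Λ * Z).trace / (Λ * ρ).trace) • ρ := rfl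

/-- Spectral data of an injective tensor. -/
structure Gapped (A : Tensor d χ) (r : ℝ) (ρ Λ : Matrix (Fin χ) (Fin χ) ℂ) : Prop where
  pos : 0 < r
  posDef_right : ρ.PosDef
  posDef_left : Λ.PosDef
  right : transfer A ρ = (r : ℂ) • ρ
  left : transferLeft A Λ = (r : ℂ) • Λ
  trace_ne : (Λ * ρ).trace ≠ 0
  gap : ∀ (μ : ℂ) (X : Matrix (Fin χ) (Fin χ) ℂ), X ≠ 0 → transfer A X = μ • X → r ≤ ‖μ‖ →
    ∃ c : ℂ, X = c • ρ

theorem IsInjective.neZero {A : Tensor d χ} (h : IsInjective A) : NeZero χ := by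
  obtain ⟨r, ρ, Λ, -, -, -, hρ, -⟩ := h
  refine ⟨?_⟩
  rintro rfl
  exact hρ.2 (Subsingleton.elim _ _)

theorem IsInjective.exists_gapped {A : Tensor d χ} (h : IsInjective A) :
    ∃ r ρ Λ, Gapped A r ρ Λ := by
  have := h.neZero
  obtain ⟨r, ρ, Λ, hr, hρ, hΛ, eρ, eΛ, hg⟩ := h
  exact ⟨r, ρ, Λ, hr, hρ, hΛ, eρ.apply_eq_smul, eΛ.apply_eq_smul, (trace_mul_pos hΛ hρ).ne',
    fun μ X hX e hμ => (hg μ X (Module.End.hasEigenvector_iff.2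
      ⟨Module.End.mem_eigenspace_iff.2 e, hX⟩) hμ).2⟩

namespace Gapped

variable {A : Tensor d χ} {r : ℝ} {ρ Λ : Matrix (Fin χ) (Fin χ) ℂ}

theorem cast_ne (h : Gapped A r ρ Λ) : (r : ℂ) ≠ 0 := by exact_mod_cast h.pos.ne'

theorem eigenProj_self (h : Gapped A r ρ Λ) : eigenProj ρ Λ ρ = ρ := by
  rw [eigenProj_apply, div_self h.trace_ne, one_smul]

theorem transfer_mul_eigenProj (h : Gapped A r ρ Λ) :
    ((r : ℂ)⁻¹ • transfer A) * eigenProj ρ Λ = eigenProj ρ Λ := by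
  ext1 Z
  rw [Module.End.mul_apply, LinearMap.smul_apply, eigenProj_apply, map_smul, h.right, smul_comm,
    inv_smul_smul₀ h.cast_ne]

theorem eigenProj_mul_transfer (h : Gapped A r ρ Λ) :
    eigenProj ρ Λ * ((r : ℂ)⁻¹ • transfer A) = eigenProj ρ Λ := by
  ext1 Z
  rw [Module.End.mul_apply, LinearMap.smul_apply, eigenProj_apply, eigenProj_apply, Matrix.mul_smul,
    Matrix.trace_smul, trace_mul_transfer, h.left, Matrix.smul_mul, Matrix.trace_smul,
    inv_smul_smul₀ h.cast_ne]

theorem eigenProj_mul_self (h : Gapped A r ρ Λ) :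
    eigenProj ρ Λ * eigenProj ρ Λ = eigenProj ρ Λ := by
  ext1 Z
  rw [Module.End.mul_apply, eigenProj_apply ρ Λ Z, map_smul, h.eigenProj_self]

/-- The projection absorbs the normalized transfer matrix from both sides, so the mixed terms
collapse. The exponent must be positive: at `0` the two sides would be `1` and `1 - P`. -/
theorem sub_eigenProj_pow (h : Gapped A r ρ Λ) (k : ℕ) :
    ((r : ℂ)⁻¹ • transfer A - eigenProj ρ Λ) ^ (k + 1) =
      ((r : ℂ)⁻¹ • transfer A) ^ (k + 1) - eigenProj ρ Λ := by
  induction k with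
  | zero => simp
  | succ k ih =>
    have hP : ∀ k : ℕ, ((r : ℂ)⁻¹ • transfer A) ^ k * eigenProj ρ Λ = eigenProj ρ Λ := by
      intro k
      induction k with
      | zero => rw [pow_zero, one_mul]
      | succ k ih => rw [pow_succ, mul_assoc, h.transfer_mul_eigenProj, ih]
    rw [pow_succ, ih, sub_mul, mul_sub, mul_sub, hP, h.eigenProj_mul_transfer,
      h.eigenProj_mul_self, sub_self, sub_zero, ← pow_succ]

/-- Subtracting the projection `P` removes exactly the dominant eigenvalue. An eigenvector with `‖μ‖
≥ 1` is killed by `P`, hence is an eigenvector of the transfer matrix itself; the gap makes it a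
multiple of `ρ`, which `P` fixes. -/
theorem norm_lt_one_of_eigen (h : Gapped A r ρ Λ) (μ : ℂ) (X : Matrix (Fin χ) (Fin χ) ℂ)
    (hX : X ≠ 0) (e : ((r : ℂ)⁻¹ • transfer A - eigenProj ρ Λ) X = μ • X) : ‖μ‖ < 1 := by
  by_contra! hμ
  have hμ0 : μ ≠ 0 := by
    rintro rfl
    norm_num at hμ
  have hPX : eigenProj ρ Λ X = 0 := by
    have e' := congrArg (eigenProj ρ Λ) e
    rw [← Module.End.mul_apply, mul_sub, h.eigenProj_mul_transfer, h.eigenProj_mul_self, sub_self,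
      LinearMap.zero_apply, map_smul] at e'
    exact (smul_eq_zero.1 e'.symm).resolve_left hμ0
  rw [LinearMap.sub_apply, hPX, sub_zero, LinearMap.smul_apply, inv_smul_eq_iff₀ h.cast_ne,
    smul_smul] at e
  obtain ⟨c, rfl⟩ := h.gap _ X hX e (by
    rw [norm_mul, Complex.norm_real, Real.norm_of_nonneg h.pos.le]
    exact le_mul_of_one_le_right h.pos.le hμ)
  rw [map_smul, h.eigenProj_self] at hPX
  exact hX hPX

attribute [local instance] Matrix.normedAddCommGroup Matrix.normedSpace

/-- The powers of the normalized transfer matrix converge to the spectral projection. -/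
theorem tendsto_functional (h : Gapped A r ρ Λ)
    (φ : Module.End ℂ (Matrix (Fin χ) (Fin χ) ℂ) →ₗ[ℂ] ℂ) :
    Tendsto (fun k : ℕ => φ (((r : ℂ)⁻¹ • transfer A) ^ k)) atTop (𝓝 (φ (eigenProj ρ Λ))) := by
  have := (tendsto_functional_pow_zero _ h.norm_lt_one_of_eigen φ).add_const (φ (eigenProj ρ Λ))
  rw [zero_add] at this
  refine this.congr' ?_
  filter_upwards [eventually_ge_atTop 1] with k hk
  obtain ⟨k, rfl⟩ := Nat.exists_eq_add_of_le' hk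
  rw [h.sub_eigenProj_pow, map_sub, sub_add_cancel]

/-- A matrix that lies in the image of every power of the normalized transfer matrix, with
uniformly bounded preimages, is a multiple of the dominant eigenvector. -/
theorem eq_smul_of_bounded (h : Gapped A r ρ Λ) {X : Matrix (Fin χ) (Fin χ) ℂ} {C : ℝ}
    (Z : ℕ → Matrix (Fin χ) (Fin χ) ℂ) (hZ : ∀ k i j, ‖Z k i j‖ ≤ C)
    (hX : ∀ k, (((r : ℂ)⁻¹ • transfer A) ^ k) (Z k) = X) : ∃ c : ℂ, X = c • ρ := by
  -- The entrywise norm bound needs `0 ≤ C`, which an entry of `Z 0` supplies unless there are no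
  -- entries at all.
  have hC : 0 ≤ C ∨ IsEmpty (Fin χ) := by
    rcases isEmpty_or_nonempty (Fin χ) with hE | ⟨⟨i⟩⟩
    · exact Or.inr hE
    · exact Or.inl ((norm_nonneg _).trans (hZ 0 i i))
  rcases hC with hC | hE
  swap
  · exact ⟨0, Subsingleton.elim _ _⟩
  have hb : ∀ k, ‖Z k‖ ≤ C := fun k => (Matrix.norm_le_iff hC).2 (hZ k)
  set D := (r : ℂ)⁻¹ • transfer A - eigenProj ρ Λ with hD
  have h0 := tendsto_end_pow_zero D h.norm_lt_one_of_eigen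
  have h1 : Tendsto (fun k : ℕ => (D ^ k) (Z k)) atTop (𝓝 0) := by
    have h2 := (tendsto_zero_iff_norm_tendsto_zero.1 h0).mul_const C
    rw [zero_mul] at h2
    refine tendsto_zero_iff_norm_tendsto_zero.2 ?_
    refine squeeze_zero (fun _ => norm_nonneg _) (fun k => ?_) h2
    refine le_trans ?_ (mul_le_mul_of_nonneg_left (hb k) (norm_nonneg _))
    rw [← map_pow]
    exact (Module.End.toContinuousLinearMap _ (D ^ k)).le_opNorm (Z k)
  have hcl : IsClosed ((Submodule.span ℂ {ρ} : Submodule ℂ (Matrix (Fin χ) (Fin χ) ℂ)) :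
      Set (Matrix (Fin χ) (Fin χ) ℂ)) := Submodule.closed_of_finiteDimensional _
  -- `X - D ^ k (Z k)` is the projection of `Z k`, so it lies in the line of `ρ`, which is closed.
  have h3 : Tendsto (fun k : ℕ => X - (D ^ k) (Z k)) atTop (𝓝 X) := by
    simpa using tendsto_const_nhds.sub h1
  have h4 : X ∈ ((Submodule.span ℂ {ρ} : Submodule ℂ (Matrix (Fin χ) (Fin χ) ℂ)) :
      Set (Matrix (Fin χ) (Fin χ) ℂ)) := by
    refine hcl.mem_of_tendsto h3 ?_
    filter_upwards [eventually_ge_atTop 1] with k hk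
    obtain ⟨k, rfl⟩ := Nat.exists_eq_add_of_le' hk
    rw [h.sub_eigenProj_pow, LinearMap.sub_apply, hX, sub_sub_cancel]
    exact Submodule.smul_mem _ _ (Submodule.mem_span_singleton_self _)
  obtain ⟨c, hc⟩ := Submodule.mem_span_singleton.1 h4
  exact ⟨c, hc.symm⟩

end Gapped

end Transfer

/-! ### Uniqueness of push-through unitaries -/

section

section EqPhase

variable {M : Type*} [AddCommGroup M] [Module ℂ M] {x y z : M}

theorem EqPhase.refl (x : M) : EqPhase x x := ⟨1, norm_one, (one_smul ℂ x).symm⟩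

theorem EqPhase.symm (h : EqPhase x y) : EqPhase y x := by
  obtain ⟨c, hc, rfl⟩ := h
  have : c ≠ 0 := norm_ne_zero_iff.1 (by rw [hc]; exact one_ne_zero)
  exact ⟨c⁻¹, by rw [norm_inv, hc, inv_one], (inv_smul_smul₀ this y).symm⟩

theorem EqPhase.trans (h : EqPhase x y) (h' : EqPhase y z) : EqPhase x z := by
  obtain ⟨c, hc, rfl⟩ := h
  obtain ⟨c', hc', rfl⟩ := h'
  exact ⟨c * c', by rw [norm_mul, hc, hc', one_mul], smul_smul _ _ _⟩

end EqPhase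

variable {d χ : ℕ}

theorem norm_eq_one_of_unitary_eq_smul_one [NeZero χ] {w : Unitary χ} {c : ℂ}
    (h : (w : Matrix (Fin χ) (Fin χ) ℂ) = c • 1) : ‖c‖ = 1 := by
  have h1 := Matrix.mem_unitaryGroup_iff.1 w.2
  rw [h, Matrix.star_eq_conjTranspose, Matrix.conjTranspose_smul, Matrix.conjTranspose_one,
    Matrix.smul_mul, Matrix.one_mul, smul_smul] at h1
  have h2 := congrFun (congrFun h1 0) 0
  rw [Matrix.smul_apply, Matrix.one_apply_eq, smul_eq_mul, mul_one, RCLike.star_def,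
    Complex.mul_conj, Complex.normSq_eq_norm_sq] at h2
  have h3 : ‖c‖ ^ 2 = 1 := by exact_mod_cast h2
  exact (pow_eq_one_iff_of_nonneg (norm_nonneg c) two_ne_zero).1 h3

theorem Unitary.conjTranspose_mul (w : Unitary χ) :
    (w : Matrix (Fin χ) (Fin χ) ℂ)ᴴ * (w : Matrix (Fin χ) (Fin χ) ℂ) = 1 :=
  Matrix.mem_unitaryGroup_iff'.1 w.2

theorem Unitary.mul_conjTranspose (w : Unitary χ) :
    (w : Matrix (Fin χ) (Fin χ) ℂ) * (w : Matrix (Fin χ) (Fin χ) ℂ)ᴴ = 1 :=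
  Matrix.mem_unitaryGroup_iff.1 w.2

theorem transfer_apply (A : Tensor d χ) (X : Matrix (Fin χ) (Fin χ) ℂ) :
    transfer A X = ∑ s, A s * X * (A s)ᴴ := rfl

theorem transferLeft_apply (A : Tensor d χ) (X : Matrix (Fin χ) (Fin χ) ℂ) :
    transferLeft A X = ∑ s, (A s)ᴴ * X * A s := by
  simp only [transferLeft, transfer_apply, conjTranspose_conjTranspose]

/-- The bound does not depend on `w`, as needed for preimages ranging over infinitely many bonds. -/
theorem norm_unitary_mul_le (w : Unitary χ) (ρ : Matrix (Fin χ) (Fin χ) ℂ) (i j : Fin χ) :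
    ‖((w : Matrix (Fin χ) (Fin χ) ℂ) * ρ) i j‖ ≤ ∑ a, ∑ b, ‖ρ a b‖ := by
  rw [Matrix.mul_apply]
  refine (norm_sum_le _ _).trans (Finset.sum_le_sum fun a _ => ?_)
  rw [norm_mul]
  refine le_trans ?_ (Finset.single_le_sum (f := fun b => ‖ρ a b‖) (fun _ _ => norm_nonneg _)
    (Finset.mem_univ j))
  exact mul_le_of_le_one_left (norm_nonneg _) (entry_norm_bound_of_unitary w.2 i a)

/-- Unitaries that move through an injective tensor along the whole chain are phases. -/
theorem IsInjective.eqPhase_one {A : Tensor d χ} (hA : IsInjective A) (w : ℤ → Unitary χ)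
    (hw : ∀ j, ∃ z : ℂ, ‖z‖ = 1 ∧ ∀ s, (w (j - 1) : Matrix (Fin χ) (Fin χ) ℂ) * A s =
      z • (A s * (w j : Matrix (Fin χ) (Fin χ) ℂ))) (j : ℤ) :
    EqPhase (w j : Matrix (Fin χ) (Fin χ) ℂ) 1 := by
  have := hA.neZero
  obtain ⟨r, ρ, Λ, h⟩ := hA.exists_gapped
  -- Inserting `ρ` as the right fixed point turns the intertwining relation into a step of the
  -- normalized transfer matrix from bond `j` to bond `j - 1`.
  have step : ∀ j, ∃ z : ℂ, ‖z‖ = 1 ∧ ((r : ℂ)⁻¹ • transfer A)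
      (z • ((w j : Matrix (Fin χ) (Fin χ) ℂ) * ρ)) = (w (j - 1) : Matrix (Fin χ) (Fin χ) ℂ) * ρ := by
    intro j
    obtain ⟨z, hz, e⟩ := hw j
    refine ⟨z, hz, ?_⟩
    rw [LinearMap.smul_apply, map_smul, inv_smul_eq_iff₀ h.cast_ne,
      ← Matrix.mul_smul (w (j - 1)).1 (r : ℂ) ρ, ← h.right, transfer_apply, transfer_apply,
      Matrix.mul_sum, Finset.smul_sum]
    refine Finset.sum_congr rfl fun s _ => ?_
    rw [← Matrix.mul_assoc, ← Matrix.mul_assoc (w (j - 1)).1, ← Matrix.mul_assoc (w (j - 1)).1, e s,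
      Matrix.smul_mul, Matrix.smul_mul]
  have iter : ∀ k : ℕ, ∃ z : ℂ, ‖z‖ = 1 ∧ (((r : ℂ)⁻¹ • transfer A) ^ k)
      (z • ((w (j + k) : Matrix (Fin χ) (Fin χ) ℂ) * ρ)) = (w j : Matrix (Fin χ) (Fin χ) ℂ) * ρ := by
    intro k
    induction k with
    | zero => exact ⟨1, norm_one, by simp⟩
    | succ k ih =>
      obtain ⟨z, hz, e⟩ := ih
      obtain ⟨z', hz', e'⟩ := step (j + (k + 1 : ℕ))
      refine ⟨z * z', by rw [norm_mul, hz, hz', one_mul], ?_⟩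
      rw [show j + ((k + 1 : ℕ) : ℤ) - 1 = j + k by push_cast; ring] at e'
      rw [pow_succ, Module.End.mul_apply, ← smul_smul, map_smul, e', e]
  choose z hz e using iter
  obtain ⟨c, hc⟩ := h.eq_smul_of_bounded _ (fun k a b => (by
    rw [Matrix.smul_apply, norm_smul, hz, one_mul]
    exact norm_unitary_mul_le _ ρ a b)) e
  have hwc : (w j : Matrix (Fin χ) (Fin χ) ℂ) = c • 1 := by
    refine h.posDef_right.isUnit.mul_right_cancel ?_
    rw [hc, Matrix.smul_mul, Matrix.one_mul]
  exact ⟨c, norm_eq_one_of_unitary_eq_smul_one hwc, hwc⟩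

theorem IsInjective.exists_ne_zero {A : Tensor d χ} (hA : IsInjective A) : ∃ s, A s ≠ 0 := by
  by_contra! h
  have := hA.neZero
  obtain ⟨r, ρ, Λ, g⟩ := hA.exists_gapped
  have h1 := g.right
  rw [transfer_apply] at h1
  simp only [h, Matrix.zero_mul, Finset.sum_const_zero] at h1
  exact (smul_ne_zero g.cast_ne g.posDef_right.isUnit.ne_zero) h1.symm

theorem act_mul (U V : Unitary d) (A : Tensor d χ) : act (U * V) A = act U (act V A) := by
  funext s
  simp only [act, Submonoid.coe_mul, Matrix.mul_apply, Finset.sum_smul, Finset.smul_sum, smul_smul]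
  exact Finset.sum_comm

theorem act_one (A : Tensor d χ) : act 1 A = A := by
  funext s
  simp [act, Matrix.one_apply]

theorem act_smul (U : Unitary d) (c : ℂ) (A : Tensor d χ) : act U (c • A) = c • act U A := by
  funext s
  simp only [act, Pi.smul_apply, Finset.smul_sum]
  exact Finset.sum_congr rfl fun t _ => smul_comm _ _ _

theorem act_mul_mul (U : Unitary d) (A : Tensor d χ) (P Q : Matrix (Fin χ) (Fin χ) ℂ) :
    act U (fun s => P * A s * Q) = fun s => P * act U A s * Q := by
  funext s
  simp only [act, Matrix.mul_sum, Matrix.sum_mul, Matrix.mul_smul, Matrix.smul_mul]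

theorem act_of_eq_smul {U V : Unitary d} {c : ℂ}
    (h : (U : Matrix (Fin d) (Fin d) ℂ) = c • (V : Matrix (Fin d) (Fin d) ℂ)) (A : Tensor d χ) :
    act U A = c • act V A := by
  funext s
  simp only [act, h, Pi.smul_apply, Finset.smul_sum, Matrix.smul_apply, smul_smul, smul_eq_mul]

namespace PushesThrough

variable {A : Tensor d χ} {U V : ℤ → Unitary d} {u v : ℤ → Unitary χ}

theorem one : PushesThrough A (fun _ => 1) (fun _ => 1) := fun j => by
  rw [act_one]
  simpa using EqPhase.refl A

theorem mul (hU : PushesThrough A U u) (hV : PushesThrough A V v) :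
    PushesThrough A (fun j => U j * V j) (fun j => u j * v j) := fun j => by
  obtain ⟨a, ha, ea⟩ := hU j
  obtain ⟨b, hb, eb⟩ := hV j
  refine ⟨b * a, by rw [norm_mul, ha, hb, one_mul], ?_⟩
  rw [act_mul, eb, act_smul, act_mul_mul, ea, ← smul_smul]
  congr 1
  funext s
  simp only [Pi.smul_apply, Submonoid.coe_mul, Matrix.conjTranspose_mul, Matrix.mul_smul,
    Matrix.smul_mul, Matrix.mul_assoc]

theorem congr_left (hU : PushesThrough A U u)
    (h : ∀ j, EqPhase (V j : Matrix (Fin d) (Fin d) ℂ) (U j : Matrix (Fin d) (Fin d) ℂ)) :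
    PushesThrough A V u := fun j => by
  obtain ⟨c, hc, e⟩ := h j
  exact EqPhase.trans ⟨c, hc, act_of_eq_smul e A⟩ (hU j)

theorem pow (hU : PushesThrough A U u) (n : ℕ) :
    PushesThrough A (fun j => U j ^ n) (fun j => u j ^ n) := by
  induction n with
  | zero => simpa only [pow_zero] using one
  | succ n ih => simpa only [pow_succ] using ih.mul hU

theorem shift (hU : PushesThrough A U u) (m : ℤ) :
    PushesThrough A (fun j => U (j + m)) (fun j => u (j + m)) := fun j => by
  have := hU (j + m)
  rwa [show j + m - 1 = j - 1 + m by ring] at this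

/-- The bond unitaries of a push-through relation are unique up to phases. -/
theorem eqPhase (hA : IsInjective A) (hu : PushesThrough A U u) (hv : PushesThrough A U v) (j : ℤ) :
    EqPhase (u j : Matrix (Fin χ) (Fin χ) ℂ) (v j : Matrix (Fin χ) (Fin χ) ℂ) := by
  -- Equating the two expressions for the same tensor shows that the ratio `u v⁻¹` moves through `A`
  -- up to a phase.
  obtain ⟨c, hc, e⟩ := hA.eqPhase_one (fun j => u j * (v j)⁻¹) (fun j => by
    obtain ⟨z, hz, e⟩ := (hv j).symm.trans (hu j)
    refine ⟨z, hz, fun s => ?_⟩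
    have e := congrFun e s
    simp only [Pi.smul_apply] at e
    have e' := congrArg (fun X => (u (j - 1)).1 * X * ((v j).1)ᴴ) e
    simp only [Matrix.mul_smul, Matrix.smul_mul] at e'
    simp only [Submonoid.coe_mul, Matrix.UnitaryGroup.inv_val, Matrix.star_eq_conjTranspose]
    rw [show (u (j - 1)).1 * ((u (j - 1)).1ᴴ * A s * (u j).1) * (v j).1ᴴ =
      ((u (j - 1)).1 * (u (j - 1)).1ᴴ) * (A s * ((u j).1 * (v j).1ᴴ)) by
        simp only [Matrix.mul_assoc], Unitary.mul_conjTranspose, Matrix.one_mul] at e'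
    rw [← e', show (u (j - 1)).1 * ((v (j - 1)).1ᴴ * A s * (v j).1) * (v j).1ᴴ =
      (u (j - 1)).1 * (v (j - 1)).1ᴴ * A s * ((v j).1 * (v j).1ᴴ) by
        simp only [Matrix.mul_assoc], Unitary.mul_conjTranspose, Matrix.mul_one]) j
  refine ⟨c, hc, ?_⟩
  have e' := congrArg (· * (v j).1) e
  simp only [Submonoid.coe_mul, Matrix.UnitaryGroup.inv_val, Matrix.star_eq_conjTranspose] at e'
  rwa [Matrix.mul_assoc, Unitary.conjTranspose_mul, Matrix.mul_one, Matrix.smul_mul,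
    Matrix.one_mul] at e'

end PushesThrough

/-! ### The bond commutator -/

/-- Phases cancel in a commutator, and multiplying `b` by `vq` on the right has no effect because
`vq` commutes with itself. -/
theorem bondInvariant_eq_of_eqPhase {vq a b : Unitary χ}
    (h : EqPhase (a : Matrix (Fin χ) (Fin χ) ℂ)
      ((b : Matrix (Fin χ) (Fin χ) ℂ) * (vq : Matrix (Fin χ) (Fin χ) ℂ))) :
    bondInvariant vq a = bondInvariant vq b := by
  obtain ⟨c, hc, e⟩ := h
  have h1 : (vq * a * vq⁻¹ : Unitary χ).1 = c • (vq * b).1 := by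
    simp only [Submonoid.coe_mul, Matrix.UnitaryGroup.inv_val, e, Matrix.mul_smul, Matrix.smul_mul,
      Matrix.star_eq_conjTranspose]
    rw [← Matrix.mul_assoc vq.1, Matrix.mul_assoc _ vq.1, Unitary.mul_conjTranspose, Matrix.mul_one]
  rw [bondInvariant, bondInvariant, mul_inv_eq_iff_eq_mul]
  apply Subtype.ext
  have h2 : (vq * b * vq⁻¹ * b⁻¹ * a).1 = (vq * b * vq⁻¹ * b⁻¹).1 * a.1 := rfl
  have h3 : (vq * b * vq⁻¹ * b⁻¹).1 * (b.1 * vq.1) = (vq * b * vq⁻¹ * b⁻¹ * (b * vq)).1 := rfl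
  rw [h1, h2, e, Matrix.mul_smul, h3, show vq * b * vq⁻¹ * b⁻¹ * (b * vq) = vq * b by group]

/-- The translation rule writes `Ud` as the product of `Ud` and `Uq` shifted by one site, so both
sides push through the same operators and uniqueness applies. -/
theorem IsDipoleSymmetry.eqPhase_bond {N L : ℕ} {Uq Ud : ℤ → Unitary d} {A : Tensor d χ}
    {vq : Unitary χ} {vd : ℤ → Unitary χ} (hU : IsDipoleSymmetry N L Uq Ud) (hA : IsInjective A)
    (hq : PushesThrough A Uq fun _ => vq) (hd : PushesThrough A Ud vd) (j : ℤ) :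
    EqPhase (vd j : Matrix (Fin χ) (Fin χ) ℂ)
      ((vd (j - 1) : Matrix (Fin χ) (Fin χ) ℂ) * (vq : Matrix (Fin χ) (Fin χ) ℂ)) := by
  have h := (hd.shift (-1)).mul (hq.shift (-1))
  have e : (fun j => Ud (j + -1) * Uq (j + -1)) = Ud := by
    funext j
    rw [hU.translate_d j, sub_eq_add_neg]
  rw [e] at h
  exact hd.eqPhase hA h j

/-- The bond commutator changes by the on-site commutation phase from each bond to the next. -/
theorem PushesThrough.exists_commutator_phase {Uq Ud : ℤ → Unitary d} {A : Tensor d χ} {ω : ℂ}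
    {vq : Unitary χ} {vd : ℤ → Unitary χ} (hω : ‖ω‖ = 1) (hA : IsInjective A)
    (hU : ∀ j, (Uq j : Matrix (Fin d) (Fin d) ℂ) * (Ud j : Matrix (Fin d) (Fin d) ℂ) =
      ω • ((Ud j : Matrix (Fin d) (Fin d) ℂ) * (Uq j : Matrix (Fin d) (Fin d) ℂ)))
    (hq : PushesThrough A Uq fun _ => vq) (hd : PushesThrough A Ud vd) :
    ∃ c : ℤ → ℂ, (∀ j, ‖c j‖ = 1) ∧ (∀ j, c j = ω * c (j - 1)) ∧
      ∀ j, (vq : Matrix (Fin χ) (Fin χ) ℂ) * (vd j : Matrix (Fin χ) (Fin χ) ℂ) =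
        c j • ((vd j : Matrix (Fin χ) (Fin χ) ℂ) * (vq : Matrix (Fin χ) (Fin χ) ℂ)) := by
  -- The products in both orders push through `Uq Ud`, since reversing the on-site order costs only
  -- the phase `ω`.
  have hqd := (hq.mul hd).eqPhase hA ((hd.mul hq).congr_left fun j => ⟨ω, hω, hU j⟩)
  choose c hc hcom using hqd
  simp only [Submonoid.coe_mul] at hcom
  refine ⟨c, hc, fun j => ?_, hcom⟩
  obtain ⟨s, hs⟩ := hA.exists_ne_zero
  obtain ⟨a, ha, ea⟩ := hq j
  obtain ⟨b, hb, eb⟩ := hd j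
  set P := (vd (j - 1)).1 * vq.1 with hP
  set Q := (vd j).1 * vq.1 with hQ
  -- Reordering the bond unitaries yields `star (c (j - 1))` on the left bond and `c j` on the right
  -- one. Comparison with the opposite order then gives `star (c (j - 1)) * c j = ω`, because some
  -- `A s` is nonzero.
  have e1 : act (Uq j) (act (Ud j) A) = (a * b * (star (c (j - 1)) * c j)) •
      fun s => Pᴴ * A s * Q := by
    rw [eb, act_smul, act_mul_mul, ea]
    funext s
    have h1 := congrArg conjTranspose (hcom (j - 1))
    rw [Matrix.conjTranspose_mul, Matrix.conjTranspose_smul] at h1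
    simp only [Pi.smul_apply, Matrix.mul_smul, Matrix.smul_mul]
    rw [show (vd (j - 1)).1ᴴ * (vq.1ᴴ * A s * vq.1) * (vd j).1 =
      ((vd (j - 1)).1ᴴ * vq.1ᴴ) * A s * (vq.1 * (vd j).1) by simp only [Matrix.mul_assoc], h1,
      hcom j]
    simp only [Matrix.mul_smul, Matrix.smul_mul, smul_smul]
    congr 1
    ring
  have e2 : act (Ud j) (act (Uq j) A) = (a * b) • fun s => Pᴴ * A s * Q := by
    rw [ea, act_smul, act_mul_mul, eb]
    funext s
    simp only [Pi.smul_apply, Matrix.mul_smul, Matrix.smul_mul, smul_smul, hP, hQ,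
      Matrix.conjTranspose_mul, Matrix.mul_assoc]
  have e3 : act (Uq j) (act (Ud j) A) = ω • act (Ud j) (act (Uq j) A) := by
    rw [← act_mul, ← act_mul]
    exact act_of_eq_smul (hU j) A
  rw [e1, e2, smul_smul] at e3
  have e4 := congrFun e3 s
  simp only [Pi.smul_apply] at e4
  have hne : Pᴴ * A s * Q ≠ 0 := by
    intro h0
    apply hs
    have hPP : P * Pᴴ = 1 := Unitary.mul_conjTranspose (vd (j - 1) * vq)
    have hQQ : Q * Qᴴ = 1 := Unitary.mul_conjTranspose (vd j * vq)
    calc A s = (P * Pᴴ) * A s * (Q * Qᴴ) := by rw [hPP, hQQ, Matrix.one_mul, Matrix.mul_one]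
      _ = P * (Pᴴ * A s * Q) * Qᴴ := by simp only [Matrix.mul_assoc]
      _ = 0 := by rw [h0, Matrix.mul_zero, Matrix.zero_mul]
  have e5 := smul_left_injective ℂ hne e4
  have hab : a * b ≠ 0 := norm_ne_zero_iff.1 (by rw [norm_mul, ha, hb]; norm_num)
  have e6 : star (c (j - 1)) * c j = ω := mul_left_cancel₀ hab (by rw [e5]; ring)
  have hcc : c (j - 1) * star (c (j - 1)) = 1 := by
    rw [RCLike.star_def, Complex.mul_conj, Complex.normSq_eq_norm_sq, hc]
    norm_num
  rw [← e6]
  linear_combination (-c j) * hcc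

theorem norm_rootPhase (N : ℕ) (k : ℤ) : ‖rootPhase N k‖ = 1 := by
  have e : rootPhase N k = Complex.exp (((2 * Real.pi * k / N : ℝ) : ℂ) * I) := by
    unfold rootPhase
    congr 1
    push_cast
    ring
  rw [e, Complex.norm_exp_ofReal_mul_I]

theorem rootPhase_add (N : ℕ) (k l : ℤ) :
    rootPhase N (k + l) = rootPhase N k * rootPhase N l := by
  rw [rootPhase, rootPhase, rootPhase, ← Complex.exp_add]
  congr 1
  push_cast
  ring

theorem rootPhase_eq_iff (N : ℕ) [NeZero N] (k l : ℤ) :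
    rootPhase N k = rootPhase N l ↔ k ≡ l [ZMOD N] := by
  have hN : (N : ℂ) ≠ 0 := NeZero.ne _
  rw [rootPhase, rootPhase, Complex.exp_eq_exp_iff_exists_int, Int.modEq_comm,
    Int.modEq_iff_dvd, dvd_def]
  refine exists_congr fun m => ?_
  have hpi : (2 * Real.pi * Complex.I : ℂ) ≠ 0 := Complex.two_pi_I_ne_zero
  constructor
  · intro h
    have h1 : 2 * Real.pi * Complex.I * ((k : ℂ) - l) = 2 * Real.pi * Complex.I * (N * m) := by
      field_simp at h
      linear_combination (2 * Real.pi * Complex.I) * h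
    have h2 := mul_left_cancel₀ hpi h1
    exact_mod_cast h2
  · intro h
    have h1 : (k : ℂ) - l = N * m := by exact_mod_cast h
    field_simp
    linear_combination h1

theorem exists_rootPhase_of_pow_eq_one (N : ℕ) [NeZero N] {c : ℂ} (h : c ^ N = 1) :
    ∃ k : ℤ, c = rootPhase N k := by
  obtain ⟨k, -, hk⟩ := (Complex.isPrimitiveRoot_exp N (NeZero.ne N)).eq_pow_of_pow_eq_one h
  refine ⟨k, ?_⟩
  rw [← hk, ← Complex.exp_nat_mul, rootPhase]
  congr 1
  push_cast
  ring

/-- The commutation phase of a unitary whose `N`-th power is a phase is an `N`-th root of unity. -/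
theorem pow_eq_one_of_commutator {N : ℕ} [NeZero χ] {v w : Unitary χ} {c : ℂ}
    (h : (v : Matrix (Fin χ) (Fin χ) ℂ) * (w : Matrix (Fin χ) (Fin χ) ℂ) =
      c • ((w : Matrix (Fin χ) (Fin χ) ℂ) * (v : Matrix (Fin χ) (Fin χ) ℂ)))
    (hv : EqPhase ((v : Matrix (Fin χ) (Fin χ) ℂ) ^ N) 1) : c ^ N = 1 := by
  have h1 : ∀ m : ℕ, v.1 ^ m * w.1 = c ^ m • (w.1 * v.1 ^ m) := by
    intro m
    induction m with
    | zero => simp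
    | succ m ih =>
      rw [pow_succ, Matrix.mul_assoc, h, Matrix.mul_smul, ← Matrix.mul_assoc, ih, Matrix.smul_mul,
        smul_smul, Matrix.mul_assoc, pow_succ, mul_comm c]
  have h2 := h1 N
  obtain ⟨z, hz, e⟩ := hv
  have hz0 : z ≠ 0 := norm_ne_zero_iff.1 (by rw [hz]; exact one_ne_zero)
  rw [e, Matrix.smul_mul, Matrix.mul_smul, Matrix.one_mul, Matrix.mul_one, smul_smul] at h2
  have hw : w.1 ≠ 0 := by
    intro h0
    have := Unitary.mul_conjTranspose w
    rw [h0, Matrix.zero_mul] at this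
    exact zero_ne_one this
  have h3 := smul_left_injective ℂ hw h2
  exact mul_right_cancel₀ hz0 (by rw [one_mul]; exact h3.symm)

theorem exists_bondInvariant_eq_rootPhase {N : ℕ} [NeZero N] {n : ℤ} {Uq Ud : ℤ → Unitary d}
    {A : Tensor d χ} {vq : Unitary χ} {vd : ℤ → Unitary χ} (hZ : IsZN N Uq)
    (hU : OnSiteProjective N n Uq Ud) (hA : IsInjective A)
    (hq : PushesThrough A Uq fun _ => vq) (hd : PushesThrough A Ud vd) :
    ∃ k : ℤ → ℤ,
      (∀ j : ℤ, (bondInvariant vq (vd j) : Matrix (Fin χ) (Fin χ) ℂ) = rootPhase N (k j) • 1) ∧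
      ∀ j : ℤ, k j ≡ k (j - 1) + n [ZMOD N] := by
  have := hA.neZero
  obtain ⟨c, -, hc, hcom⟩ := hq.exists_commutator_phase (norm_rootPhase N n) hA hU hd
  -- Both `vq ^ N` and `1` push through `Uq ^ N ≐ 1`.
  have hv : EqPhase ((vq : Matrix (Fin χ) (Fin χ) ℂ) ^ N) 1 :=
    ((hq.pow N).eqPhase hA (PushesThrough.one.congr_left fun j => hZ j)) 0
  choose k hk using fun j => exists_rootPhase_of_pow_eq_one N (pow_eq_one_of_commutator (hcom j) hv)
  refine ⟨k, fun j => ?_, fun j => ?_⟩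
  · simp only [bondInvariant, Submonoid.coe_mul, Matrix.UnitaryGroup.inv_val,
      Matrix.star_eq_conjTranspose]
    rw [hcom j, Matrix.smul_mul, Matrix.smul_mul, Matrix.mul_assoc (vd j).1,
      Unitary.mul_conjTranspose, Matrix.mul_one, Unitary.mul_conjTranspose, hk]
  · rw [← rootPhase_eq_iff, rootPhase_add, ← hk, ← hk, hc, mul_comm]

end

/-! ### Overlaps as traces of mixed transfer matrices -/

section

theorem _root_.List.prod_ofFn_sum {R ι : Type*} [Semiring R] [Fintype ι] :
    ∀ {M : ℕ} (f : Fin M → ι → R), (List.ofFn fun i => ∑ a, f i a).prod =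
      ∑ s : Fin M → ι, (List.ofFn fun i => f i (s i)).prod
  | 0, f => by simp
  | M + 1, f => by
    rw [List.ofFn_succ, List.prod_cons, List.prod_ofFn_sum (fun i => f i.succ), Finset.sum_mul_sum,
      ← Fintype.sum_prod_type']
    refine Fintype.sum_equiv (Fin.consEquiv fun _ => ι) _ _ fun p => ?_
    rw [List.ofFn_succ, List.prod_cons]
    rfl

variable {d χ : ℕ}

/-- The operator `X ↦ P X Q†` on bond matrices. -/
noncomputable def sandwich (P Q : Matrix (Fin χ) (Fin χ) ℂ) :
    Module.End ℂ (Matrix (Fin χ) (Fin χ) ℂ) where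
  toFun X := P * X * Qᴴ
  map_add' X Y := by simp only [Matrix.mul_add, Matrix.add_mul]
  map_smul' c X := by simp only [Matrix.mul_smul, Matrix.smul_mul, RingHom.id_apply]

theorem sandwich_apply (P Q X : Matrix (Fin χ) (Fin χ) ℂ) : sandwich P Q X = P * X * Qᴴ := rfl

theorem sandwich_mul (P Q P' Q' : Matrix (Fin χ) (Fin χ) ℂ) :
    sandwich (P * P') (Q * Q') = sandwich P Q * sandwich P' Q' := by
  ext1 X
  simp only [Module.End.mul_apply, sandwich_apply, Matrix.conjTranspose_mul, Matrix.mul_assoc]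

theorem prod_ofFn_sandwich : ∀ {M : ℕ} (P Q : Fin M → Matrix (Fin χ) (Fin χ) ℂ),
    (List.ofFn fun i => sandwich (P i) (Q i)).prod = sandwich (List.ofFn P).prod (List.ofFn Q).prod
  | 0, P, Q => by
    ext1 X
    simp [sandwich_apply]
  | M + 1, P, Q => by
    rw [List.ofFn_succ, List.prod_cons, prod_ofFn_sandwich, List.ofFn_succ, List.prod_cons,
      List.ofFn_succ, List.prod_cons, sandwich_mul]

/-- The operator is `P ⊗ Q̄`, whose trace is computed in the basis of matrix units. -/
theorem trace_sandwich (P Q : Matrix (Fin χ) (Fin χ) ℂ) :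
    LinearMap.trace ℂ _ (sandwich P Q) = P.trace * star Q.trace := by
  rw [LinearMap.trace_eq_matrix_trace ℂ (Matrix.stdBasis ℂ (Fin χ) (Fin χ)), Matrix.trace,
    Fintype.sum_prod_type, Matrix.trace, Matrix.trace, star_sum, Finset.sum_mul_sum]
  refine Finset.sum_congr rfl fun i _ => Finset.sum_congr rfl fun j _ => ?_
  rw [Matrix.diag_apply, LinearMap.toMatrix_apply, Matrix.stdBasis_eq_single, sandwich_apply]
  have : ∀ Y : Matrix (Fin χ) (Fin χ) ℂ, (Matrix.stdBasis ℂ (Fin χ) (Fin χ)).repr Y (i, j) = Y i j :=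
    fun Y => rfl
  rw [this, Matrix.mul_apply, Finset.sum_eq_single j]
  · simp
  · intro k _ hk
    simp [Matrix.mul_single_apply_of_ne, hk]
  · simp

/-- The mixed transfer matrix `X ↦ ∑ₛ Bˢ X (Aˢ)†`. -/
noncomputable def mixedTransfer (B A : Tensor d χ) : Module.End ℂ (Matrix (Fin χ) (Fin χ) ℂ) :=
  ∑ s, sandwich (B s) (A s)

theorem mixedTransfer_apply (B A : Tensor d χ) (X : Matrix (Fin χ) (Fin χ) ℂ) :
    mixedTransfer B A X = ∑ s, B s * X * (A s)ᴴ := by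
  simp only [mixedTransfer, LinearMap.sum_apply, sandwich_apply]

theorem mixedTransfer_self (A : Tensor d χ) : mixedTransfer A A = transfer A := by
  ext1 X
  rw [mixedTransfer_apply, transfer_apply]

/-- Expanding the product over words in the physical indices gives the overlap of the MPS built from
the `B i` with that of `A`. -/
theorem trace_prod_mixedTransfer {M : ℕ} (B : Fin M → Tensor d χ) (A : Tensor d χ) :
    LinearMap.trace ℂ _ (List.ofFn fun i => mixedTransfer (B i) A).prod =
      ∑ s : Fin M → Fin d, (List.ofFn fun i => B i (s i)).prod.trace * star (state A M s) := by
  simp only [mixedTransfer, List.prod_ofFn_sum, map_sum, prod_ofFn_sandwich, trace_sandwich, state]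

theorem prod_ofFn_smul {R : Type*} [Ring R] [Algebra ℂ R] : ∀ {M : ℕ} (c : Fin M → ℂ) (f : Fin M → R),
    (List.ofFn fun i => c i • f i).prod = (∏ i, c i) • (List.ofFn f).prod
  | 0, c, f => by simp
  | M + 1, c, f => by
    rw [List.ofFn_succ, List.prod_cons, prod_ofFn_smul, List.ofFn_succ, List.prod_cons,
      Fin.prod_univ_succ, smul_mul_smul_comm]

theorem globalOp_mulVec_state (U : ℤ → Unitary d) (A : Tensor d χ) (M : ℕ) (s : Fin M → Fin d) :
    (globalOp U M *ᵥ state A M) s =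
      (List.ofFn fun i : Fin M => act (U ((i : ℤ) + 1)) A (s i)).prod.trace := by
  simp only [act, List.prod_ofFn_sum, prod_ofFn_smul, Matrix.trace_sum, Matrix.trace_smul,
    smul_eq_mul, Matrix.mulVec, dotProduct, globalOp, Matrix.of_apply, state]

/-- For a symmetric tensor, the mixed transfer matrix of the unit cell has the same traces of
powers as the transfer matrix, up to phases. -/
theorem IsSymmetric.norm_trace_eq {L : ℕ} {U : ℤ → Unitary d} {A : Tensor d χ}
    (hU : Function.Periodic U (L : ℤ)) (h : IsSymmetric L U A) {k : ℕ} (hk : 0 < k) :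
    ‖LinearMap.trace ℂ _
      ((List.ofFn fun i : Fin L => mixedTransfer (act (U ((i : ℤ) + 1)) A) A).prod ^ k)‖ =
    ‖LinearMap.trace ℂ _ (transfer A ^ (k * L))‖ := by
  obtain ⟨z, hz, e⟩ := h k hk
  -- By periodicity of `U`, a chain of `k * L` sites is `k` copies of the unit cell.
  have h1 : (List.ofFn fun i : Fin L => mixedTransfer (act (U ((i : ℤ) + 1)) A) A).prod ^ k =
      (List.ofFn fun i : Fin (k * L) => mixedTransfer (act (U ((i : ℤ) + 1)) A) A).prod := by
    rw [List.ofFn_mul, List.prod_flatten, List.map_ofFn, ← List.prod_replicate,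
      ← List.ofFn_const]
    congr 2
    funext i
    simp only [Function.comp_apply]
    congr 2
    funext j
    have : U (((i * L + j : ℕ) : ℤ) + 1) = U ((j : ℤ) + 1) := by
      rw [show (((i * L + j : ℕ) : ℤ) + 1) = (j : ℤ) + 1 + (i : ℕ) * (L : ℤ) by push_cast; ring]
      exact hU.nat_mul i _
    rw [this]
  have h2 : transfer A ^ (k * L) = (List.ofFn fun _ : Fin (k * L) => mixedTransfer A A).prod := by
    rw [List.ofFn_const, List.prod_replicate, mixedTransfer_self]
  rw [h1, h2, trace_prod_mixedTransfer, trace_prod_mixedTransfer]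
  simp only [← globalOp_mulVec_state, e, Pi.smul_apply, smul_eq_mul, mul_assoc]
  rw [← Finset.mul_sum, norm_mul, hz, one_mul]
  rfl

end

/-! ### Contraction by mixed transfer matrices -/

section

variable {d χ : ℕ}

theorem trace_eigenProj {ρ Λ : Matrix (Fin χ) (Fin χ) ℂ} (h : (Λ * ρ).trace ≠ 0) :
    LinearMap.trace ℂ _ (eigenProj ρ Λ) = 1 := by
  let f : Matrix (Fin χ) (Fin χ) ℂ →ₗ[ℂ] ℂ :=
    (Λ * ρ).trace⁻¹ • (Matrix.traceLinearMap (Fin χ) ℂ ℂ ∘ₗ LinearMap.mulLeft ℂ Λ)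
  have e : eigenProj ρ Λ = f.smulRight ρ := by
    ext1 Z
    simp [eigenProj_apply, f, div_eq_inv_mul]
  rw [e, LinearMap.trace_smulRight]
  simp [f, h]

/-- The identity is a left fixed point; pairing it with `ρ`, whose trace is positive, forces `r =
1`. -/
theorem IsLeftCanonical.gapped {A : Tensor d χ} (hL : IsLeftCanonical A) (hA : IsInjective A) :
    ∃ ρ, Gapped A 1 ρ 1 := by
  have := hA.neZero
  obtain ⟨r, ρ, Λ, h⟩ := hA.exists_gapped
  have hl : transferLeft A 1 = 1 := by
    rw [transferLeft_apply]
    simpa only [Matrix.mul_one, IsLeftCanonical] using hL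
  have ht : ρ.trace ≠ 0 := h.posDef_right.trace_pos.ne'
  have hr : (r : ℂ) = 1 := by
    have h1 := trace_mul_transfer A 1 ρ
    rw [hl, h.right, Matrix.one_mul, Matrix.one_mul, Matrix.trace_smul, smul_eq_mul] at h1
    exact mul_right_cancel₀ ht (by rw [h1, one_mul])
  have hr' : r = 1 := by exact_mod_cast hr
  subst hr'
  exact ⟨ρ, h.pos, h.posDef_right, Matrix.PosDef.one, h.right, by simpa using hl,
    by rwa [Matrix.one_mul], h.gap⟩

/-- The columns of `U` are orthonormal. -/
theorem sum_act_conjTranspose_mul_act (U : Unitary d) (A : Tensor d χ)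
    (M : Matrix (Fin χ) (Fin χ) ℂ) :
    ∑ s, (act U A s)ᴴ * M * act U A s = ∑ s, (A s)ᴴ * M * A s := by
  have hU : ∀ t t', ∑ s, star (U.1 s t) * U.1 s t' = (1 : Matrix (Fin d) (Fin d) ℂ) t t' := by
    intro t t'
    rw [← Unitary.conjTranspose_mul U, Matrix.mul_apply]
    rfl
  calc ∑ s, (act U A s)ᴴ * M * act U A s
      = ∑ s, ∑ t, ∑ t', (star (U.1 s t) * U.1 s t') • ((A t)ᴴ * M * A t') := by
        refine Finset.sum_congr rfl fun s _ => ?_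
        simp only [act, Matrix.conjTranspose_sum, Matrix.conjTranspose_smul, Matrix.sum_mul,
          Matrix.mul_sum, Matrix.smul_mul, Matrix.mul_smul, Finset.smul_sum, smul_smul]
        rw [Finset.sum_comm]
        refine Finset.sum_congr rfl fun t _ => Finset.sum_congr rfl fun t' _ => ?_
        rw [mul_comm]
    _ = ∑ t, ∑ t', (∑ s, star (U.1 s t) * U.1 s t') • ((A t)ᴴ * M * A t') := by
        rw [Finset.sum_comm]
        refine Finset.sum_congr rfl fun t _ => ?_
        rw [Finset.sum_comm]
        simp only [Finset.sum_smul]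
    _ = ∑ t, (A t)ᴴ * M * A t := by
        simp only [hU, Matrix.one_apply, ite_smul, one_smul, zero_smul, Finset.sum_ite_eq,
          Finset.mem_univ, if_true]

/-- The squared norm `Tr (W ρ W†)` of a bond matrix, weighted by the right eigenvector. -/
noncomputable def weightedNormSq (ρ W : Matrix (Fin χ) (Fin χ) ℂ) : ℝ :=
  (W * ρ * Wᴴ).trace.re

theorem weightedNormSq_nonneg {ρ : Matrix (Fin χ) (Fin χ) ℂ} (hρ : ρ.PosDef)
    (W : Matrix (Fin χ) (Fin χ) ℂ) : 0 ≤ weightedNormSq ρ W :=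
  (Complex.le_def.1 (hρ.posSemidef.mul_mul_conjTranspose_same W).trace_nonneg).1

theorem eq_zero_of_weightedNormSq_le {ρ W : Matrix (Fin χ) (Fin χ) ℂ} (hρ : ρ.PosDef)
    (h : weightedNormSq ρ W ≤ 0) : W = 0 := by
  have h0 := (hρ.posSemidef.mul_mul_conjTranspose_same W).trace_nonneg
  have h1 : (W * ρ * Wᴴ).trace = 0 := by
    have := Complex.le_def.1 h0
    exact Complex.ext (le_antisymm h this.1) this.2.symm
  obtain ⟨S, hS, rfl⟩ := hρ.exists_eq_conjTranspose_mul_self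
  have h2 : W * (Sᴴ * S) * Wᴴ = (W * Sᴴ) * (W * Sᴴ)ᴴ := by
    simp only [Matrix.conjTranspose_mul, Matrix.conjTranspose_conjTranspose, Matrix.mul_assoc]
  rw [h2, Matrix.trace_mul_conjTranspose_self_eq_zero_iff] at h1
  exact ((Matrix.isUnit_conjTranspose S).2 hS).mul_right_cancel (by rw [h1, Matrix.zero_mul])

theorem weightedNormSq_smul (ρ W : Matrix (Fin χ) (Fin χ) ℂ) (c : ℂ) :
    weightedNormSq ρ (c • W) = ‖c‖ ^ 2 * weightedNormSq ρ W := by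
  rw [weightedNormSq, weightedNormSq, Matrix.conjTranspose_smul, Matrix.smul_mul, Matrix.smul_mul,
    Matrix.mul_smul, smul_smul, Matrix.trace_smul, smul_eq_mul, RCLike.star_def, Complex.mul_conj,
    Complex.normSq_eq_norm_sq, Complex.re_ofReal_mul]

/-- The defect in the contraction by a mixed transfer matrix. -/
theorem sum_weightedNormSq_sub {A B : Tensor d χ} {ρ Y Y' : Matrix (Fin χ) (Fin χ) ℂ}
    (hρ : ρ.PosDef) (hA : transfer A ρ = ρ) (hB : IsLeftCanonical B)
    (h : mixedTransfer B A (Y * ρ) = Y' * ρ) :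
    ∑ s, weightedNormSq ρ (B s * Y - Y' * A s) = weightedNormSq ρ Y - weightedNormSq ρ Y' := by
  rw [transfer_apply] at hA
  rw [mixedTransfer_apply] at h
  have h' : ∑ s, A s * (ρ * Yᴴ) * (B s)ᴴ = ρ * Y'ᴴ := by
    have := congrArg conjTranspose h
    simpa only [Matrix.conjTranspose_sum, Matrix.conjTranspose_mul,
      Matrix.conjTranspose_conjTranspose, hρ.isHermitian.eq, Matrix.mul_assoc] using this
  unfold IsLeftCanonical at hB
  -- The four terms of the expanded square: `e1` uses that `B` is left-canonical, `e2` and `e3` use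
  -- `h` and its adjoint, and `e4` uses that `ρ` is fixed. All but the first equal the term of `Y'`.
  have e1 : ∑ s, (B s * Y * ρ * (Yᴴ * (B s)ᴴ)).trace = (Y * ρ * Yᴴ).trace := by
    calc _ = ((∑ s, (B s)ᴴ * B s) * (Y * ρ * Yᴴ)).trace := by
          rw [Matrix.sum_mul, Matrix.trace_sum]
          refine Finset.sum_congr rfl fun s _ => ?_
          rw [← Matrix.mul_assoc _ Yᴴ, Matrix.trace_mul_comm]
          simp only [Matrix.mul_assoc]
      _ = _ := by rw [hB, Matrix.one_mul]
  have e2 : ∑ s, (B s * Y * ρ * ((A s)ᴴ * Y'ᴴ)).trace = (Y' * ρ * Y'ᴴ).trace := by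
    rw [← h, Matrix.sum_mul, Matrix.trace_sum]
    simp only [Matrix.mul_assoc]
  have e3 : ∑ s, (Y' * A s * ρ * (Yᴴ * (B s)ᴴ)).trace = (Y' * ρ * Y'ᴴ).trace := by
    rw [Matrix.mul_assoc, ← h', Matrix.mul_sum, Matrix.trace_sum]
    simp only [Matrix.mul_assoc]
  have e4 : ∑ s, (Y' * A s * ρ * ((A s)ᴴ * Y'ᴴ)).trace = (Y' * ρ * Y'ᴴ).trace := by
    conv_rhs => rw [← hA, Matrix.mul_sum, Matrix.sum_mul, Matrix.trace_sum]
    simp only [Matrix.mul_assoc]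
  have key : ∑ s, ((B s * Y - Y' * A s) * ρ * (B s * Y - Y' * A s)ᴴ).trace =
      (Y * ρ * Yᴴ).trace - (Y' * ρ * Y'ᴴ).trace := by
    simp only [Matrix.conjTranspose_sub, Matrix.conjTranspose_mul, Matrix.sub_mul, Matrix.mul_sub,
      Matrix.trace_sub, Finset.sum_sub_distrib]
    rw [e1, e2, e3, e4, sub_self, sub_zero]
  have key' := congrArg Complex.re key
  rw [Complex.re_sum, Complex.sub_re] at key'
  exact key'

/-- The mixed transfer matrix of the unit cell of a symmetric tensor has an eigenvalue outside the
open unit disc. -/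
theorem IsSymmetric.exists_eigenvector {L : ℕ} [NeZero L] {U : ℤ → Unitary d} {A : Tensor d χ}
    {ρ : Matrix (Fin χ) (Fin χ) ℂ}
    (hU : Function.Periodic U (L : ℤ)) (h : IsSymmetric L U A) (hA : Gapped A 1 ρ 1) :
    ∃ (μ : ℂ) (X : Matrix (Fin χ) (Fin χ) ℂ), X ≠ 0 ∧ 1 ≤ ‖μ‖ ∧
      (List.ofFn fun i : Fin L => mixedTransfer (act (U ((i : ℤ) + 1)) A) A).prod X = μ • X := by
  by_contra! hne
  let _ := Matrix.normedAddCommGroup (m := Fin χ) (n := Fin χ) (α := ℂ)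
  let _ := Matrix.normedSpace (m := Fin χ) (n := Fin χ) (α := ℂ) (R := ℂ)
  set M := (List.ofFn fun i : Fin L => mixedTransfer (act (U ((i : ℤ) + 1)) A) A).prod
  -- Were all eigenvalues inside the disc, the traces of `M ^ k` would tend to `0`; their moduli are
  -- those of `transfer A ^ (k * L)`, which tend to the trace `1` of the rank-one projection.
  have h1 := (tendsto_functional_pow_zero M (fun μ X hX e => by
    by_contra! hμ
    exact hne μ X hX hμ e) (LinearMap.trace ℂ _)).norm
  have h2 := (hA.tendsto_functional (LinearMap.trace ℂ _)).norm
  rw [trace_eigenProj hA.trace_ne, norm_one] at h2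
  simp only [Complex.ofReal_one, inv_one, one_smul] at h2
  have h3 : Tendsto (fun k : ℕ => k * L) atTop atTop :=
    tendsto_id.atTop_mul_const' (Nat.pos_of_ne_zero (NeZero.ne L))
  have h4 := h1.congr' (f₂ := fun k => ‖LinearMap.trace ℂ _ (transfer A ^ (k * L))‖) (by
    filter_upwards [eventually_gt_atTop 0] with k hk
    exact h.norm_trace_eq hU hk)
  have h5 := tendsto_nhds_unique h4 (h2.comp h3)
  norm_num at h5

/-- The leftmost factor of a product of endomorphisms acts last, hence the reversed index `m - 1 -
i`. -/
theorem prod_ofFn_apply_rec {R V : Type*} [CommSemiring R] [AddCommMonoid V] [Module R V]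
    (F : ℕ → Module.End R V) (x : ℕ → V) (hx : ∀ i, x (i + 1) = F i (x i)) (m : ℕ) :
    (List.ofFn fun i : Fin m => F (m - 1 - i)).prod (x 0) = x m := by
  induction m with
  | zero => simp
  | succ m ih =>
    rw [List.ofFn_succ, List.prod_cons, Module.End.mul_apply, hx m, ← ih]
    simp [Nat.sub_sub, Nat.add_comm]

end

/-! ### From symmetry to push-through unitaries -/

section

variable {d χ : ℕ}

theorem IsLeftCanonical.act {A : Tensor d χ} (hA : IsLeftCanonical A) (U : Unitary d) :
    IsLeftCanonical (act U A) := by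
  unfold IsLeftCanonical at hA ⊢
  simpa only [Matrix.mul_one, hA] using sum_act_conjTranspose_mul_act U A 1

/-- Intertwiners between `A` and the transformed tensors at the successive sites `0, -1, -2, …`. -/
theorem IsSymmetric.exists_intertwiner {L : ℕ} [NeZero L] {U : ℤ → Unitary d} {A : Tensor d χ}
    {ρ : Matrix (Fin χ) (Fin χ) ℂ} (hU : Function.Periodic U (L : ℤ)) (h : IsSymmetric L U A)
    (hL : IsLeftCanonical A) (hA : Gapped A 1 ρ 1) :
    ∃ (μ : ℂ) (y : ℕ → Matrix (Fin χ) (Fin χ) ℂ), ‖μ‖ = 1 ∧ (∀ i, y i ≠ 0) ∧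
      (∀ i, y (i + L) = μ • y i) ∧
      ∀ (i : ℕ) s, DipoleLSM.act (U (-(i : ℤ))) A s * y i = y (i + 1) * A s := by
  obtain ⟨μ, X, hX, hμ, e⟩ := h.exists_eigenvector hU hA
  have hρ := hA.posDef_right
  have hρu : IsUnit ρ.det := (Matrix.isUnit_iff_isUnit_det ρ).1 hρ.isUnit
  have hright : transfer A ρ = ρ := by simpa using hA.right
  -- The factor of site `L ≡ 0` acts first on `X`, so the iteration runs down the sites `0, -1, -2,
  -- …`.
  let F : ℕ → Module.End ℂ (Matrix (Fin χ) (Fin χ) ℂ) :=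
    fun i => mixedTransfer (DipoleLSM.act (U (-(i : ℤ))) A) A
  obtain ⟨x, hx0, hx⟩ : ∃ x : ℕ → Matrix (Fin χ) (Fin χ) ℂ, x 0 = X ∧ ∀ i, x (i + 1) = F i (x i) :=
    ⟨fun i => Nat.rec X (fun i Y => F i Y) i, rfl, fun _ => rfl⟩
  have hF : ∀ i, F (i + L) = F i := by
    intro i
    have : U (-((i + L : ℕ) : ℤ)) = U (-(i : ℤ)) := by
      rw [show (-((i + L : ℕ) : ℤ)) = -(i : ℤ) - L by push_cast; ring, hU.sub_eq]
    simp only [F, this]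
  have hxL : ∀ i, x (i + L) = μ • x i := by
    intro i
    induction i with
    | zero =>
      rw [zero_add, ← prod_ofFn_apply_rec F x hx L, hx0]
      refine Eq.trans ?_ e
      congr 2
      refine congrArg List.ofFn (funext fun i => ?_)
      have : U (-((L - 1 - i : ℕ) : ℤ)) = U ((i : ℤ) + 1) := by
        rw [show (-((L - 1 - i : ℕ) : ℤ)) = (i : ℤ) + 1 - L by have := i.2; omega, hU.sub_eq]
      simp only [F, this]
    | succ i ih => rw [show i + 1 + L = i + L + 1 by ring, hx, hx, hF, ih, map_smul]
  -- Removing `ρ` puts the iterates in the form required by the defect identity.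
  let y : ℕ → Matrix (Fin χ) (Fin χ) ℂ := fun i => x i * ρ⁻¹
  have hyx : ∀ i, y i * ρ = x i := fun i => Matrix.nonsing_inv_mul_cancel_right _ _ hρu
  have hyL : ∀ i, y (i + L) = μ • y i := fun i => by
    simp only [y, hxL, Matrix.smul_mul]
  have hid : ∀ i : ℕ, ∑ s, weightedNormSq ρ (DipoleLSM.act (U (-(i : ℤ))) A s * y i - y (i + 1) * A s) =
      weightedNormSq ρ (y i) - weightedNormSq ρ (y (i + 1)) := fun i =>
    sum_weightedNormSq_sub hρ hright (hL.act _) (by rw [hyx, hyx, hx i])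
  have hstep : ∀ i, weightedNormSq ρ (y (i + 1)) ≤ weightedNormSq ρ (y i) := fun i =>
    sub_nonneg.1 ((Finset.sum_nonneg fun s _ => weightedNormSq_nonneg hρ _).trans_eq (hid i))
  have hanti : Antitone fun i => weightedNormSq ρ (y i) := antitone_nat_of_succ_le hstep
  -- The weighted norm never increases along the chain, yet one unit cell multiplies it by `‖μ‖ ^ 2
  -- ≥ 1`. It is therefore constant, all defects vanish and `‖μ‖ = 1`.
  have hle : ∀ i, weightedNormSq ρ (y i) ≤ weightedNormSq ρ (y (i + L)) := fun i => by
    rw [hyL, weightedNormSq_smul]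
    exact le_mul_of_one_le_left (weightedNormSq_nonneg hρ _) (one_le_pow₀ hμ)
  have heq : ∀ i, weightedNormSq ρ (y (i + 1)) = weightedNormSq ρ (y i) := fun i =>
    le_antisymm (hstep i)
      ((hle i).trans (hanti (Nat.add_le_add_left (Nat.one_le_iff_ne_zero.2 (NeZero.ne L)) i)))
  have hconst : ∀ i, weightedNormSq ρ (y i) = weightedNormSq ρ (y 0) := fun i => by
    induction i with
    | zero => rfl
    | succ i ih => rw [heq, ih]
  have hpos : 0 < weightedNormSq ρ (y 0) := by
    by_contra! h0
    have h1 := hyx 0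
    rw [eq_zero_of_weightedNormSq_le hρ h0, Matrix.zero_mul, hx0] at h1
    exact hX h1.symm
  refine ⟨μ, y, ?_, fun i h0 => ?_, hyL, fun i s => ?_⟩
  · have h1 := hconst (0 + L)
    rw [hyL, weightedNormSq_smul] at h1
    exact (pow_eq_one_iff_of_nonneg (norm_nonneg μ) two_ne_zero).1
      (mul_right_cancel₀ hpos.ne' (by rw [h1, one_mul]))
  · have h1 := hconst i
    rw [h0, ← zero_smul ℂ (0 : Matrix (Fin χ) (Fin χ) ℂ), weightedNormSq_smul, norm_zero,
      zero_pow two_ne_zero, zero_mul] at h1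
    exact hpos.ne h1
  · have h1 := hid i
    rw [heq, sub_self, Finset.sum_eq_zero_iff_of_nonneg fun s _ => weightedNormSq_nonneg hρ _] at h1
    exact sub_eq_zero.1 (eq_zero_of_weightedNormSq_le hρ (h1 s (Finset.mem_univ s)).le)

/-- A bond matrix fixed by a power of the transfer matrix of a left-canonical tensor is scalar. -/
theorem Gapped.eq_smul_one_of_trace {A : Tensor d χ} {ρ : Matrix (Fin χ) (Fin χ) ℂ}
    (hA : Gapped A 1 ρ 1) {L : ℕ} [NeZero L] {Q : Matrix (Fin χ) (Fin χ) ℂ}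
    (hQ : ∀ m Z, (Q * (transfer A ^ (m * L)) Z).trace = (Q * Z).trace) : ∃ c : ℂ, Q = c • 1 := by
  -- The limit of `tr (Q E ^ (m * L) Z)` is `tr Z * tr (Q ρ) / tr ρ`, which supplies the scalar.
  refine ⟨(Q * ρ).trace / ρ.trace, Matrix.ext_iff_trace_mul_right.2 fun Z => ?_⟩
  let φ : Module.End ℂ (Matrix (Fin χ) (Fin χ) ℂ) →ₗ[ℂ] ℂ :=
    Matrix.traceLinearMap (Fin χ) ℂ ℂ ∘ₗ LinearMap.mulLeft ℂ Q ∘ₗ LinearMap.applyₗ Z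
  have h1 := hA.tendsto_functional φ
  simp only [Complex.ofReal_one, inv_one, one_smul] at h1
  have h2 : Tendsto (fun m : ℕ => m * L) atTop atTop :=
    tendsto_id.atTop_mul_const' (Nat.pos_of_ne_zero (NeZero.ne L))
  have h3 : Tendsto (fun _ : ℕ => (Q * Z).trace) atTop (𝓝 (φ (eigenProj ρ 1))) :=
    (h1.comp h2).congr fun m => hQ m Z
  rw [tendsto_nhds_unique tendsto_const_nhds h3]
  change (Q * eigenProj ρ 1 Z).trace = _
  rw [eigenProj_apply, Matrix.mul_smul, Matrix.trace_smul, Matrix.smul_mul, Matrix.trace_smul,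
    Matrix.one_mul, Matrix.one_mul, smul_eq_mul, smul_eq_mul]
  ring

theorem exists_unitary_of_conjTranspose_mul_self {Y : Matrix (Fin χ) (Fin χ) ℂ} [NeZero χ] {c : ℂ}
    (hY : Y ≠ 0) (h : Yᴴ * Y = c • 1) : ∃ t : ℝ, c = t ∧ 0 < t ∧
      (((Real.sqrt t : ℝ) : ℂ)⁻¹ • Y) ∈ Matrix.unitaryGroup (Fin χ) ℂ := by
  have hps := (Matrix.posSemidef_conjTranspose_mul_self Y).diag_nonneg (i := 0)
  rw [h, Matrix.smul_apply, Matrix.one_apply_eq, smul_eq_mul, mul_one] at hps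
  have hc : c ≠ 0 := by
    rintro rfl
    rw [zero_smul, Matrix.conjTranspose_mul_self_eq_zero] at h
    exact hY h
  obtain ⟨h1, h2⟩ := Complex.le_def.1 hps
  have hct : c = (c.re : ℂ) := Complex.ext rfl h2.symm
  have ht : 0 < c.re := lt_of_le_of_ne h1 fun h0 => hc (by rw [hct, ← h0]; rfl)
  refine ⟨c.re, hct, ht, ?_⟩
  rw [Matrix.mem_unitaryGroup_iff', Matrix.star_eq_conjTranspose, Matrix.conjTranspose_smul,
    Matrix.smul_mul, Matrix.mul_smul, h, smul_smul, smul_smul, hct]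
  have hs : ((Real.sqrt c.re : ℝ) : ℂ) * ((Real.sqrt c.re : ℝ) : ℂ) = (c.re : ℂ) := by
    rw [← Complex.ofReal_mul, Real.mul_self_sqrt ht.le]
  have hs0 : ((Real.sqrt c.re : ℝ) : ℂ) ≠ 0 := by
    exact_mod_cast (Real.sqrt_pos.2 ht).ne'
  rw [star_inv₀, RCLike.star_def, Complex.conj_ofReal, Complex.ofReal_re]
  rw [← hs, mul_assoc, inv_mul_cancel_left₀ hs0, inv_mul_cancel₀ hs0, one_smul]

/-- For the intertwiners `y i`, the matrices `y† y` are carried to one another by the left transfer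
matrix and recur after `L` steps because `‖μ‖ = 1`. The gap makes them scalar, and since the left
transfer matrix fixes `1` the scalar is the same on every bond, so a single rescaling serves all of
them. -/
theorem IsSymmetric.exists_unitary_intertwiner {L : ℕ} [NeZero L] {U : ℤ → Unitary d}
    {A : Tensor d χ} (hU : Function.Periodic U (L : ℤ)) (h : IsSymmetric L U A)
    (hL : IsLeftCanonical A) (hA : IsInjective A) :
    ∃ w : ℕ → Unitary χ,
      (∀ i, EqPhase (w (i + L) : Matrix (Fin χ) (Fin χ) ℂ) (w i : Matrix (Fin χ) (Fin χ) ℂ)) ∧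
      ∀ (i : ℕ) s, act (U (-(i : ℤ))) A s * (w i : Matrix (Fin χ) (Fin χ) ℂ) =
        (w (i + 1) : Matrix (Fin χ) (Fin χ) ℂ) * A s := by
  have := hA.neZero
  obtain ⟨ρ, hG⟩ := hL.gapped hA
  obtain ⟨μ, y, hμ, hy0, hyL, hy⟩ := h.exists_intertwiner hU hL hG
  have hQ : ∀ i, transferLeft A ((y (i + 1))ᴴ * y (i + 1)) = (y i)ᴴ * y i := by
    intro i
    have hc := hL.act (U (-(i : ℤ)))
    unfold IsLeftCanonical at hc
    rw [transferLeft_apply]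
    calc _ = ∑ s, (y i)ᴴ * ((act (U (-(i : ℤ))) A s)ᴴ * act (U (-(i : ℤ))) A s) * y i := by
          refine Finset.sum_congr rfl fun s _ => ?_
          have h1 := congrArg conjTranspose (hy i s)
          rw [Matrix.conjTranspose_mul, Matrix.conjTranspose_mul] at h1
          rw [← Matrix.mul_assoc, ← h1, Matrix.mul_assoc, ← hy i s]
          simp only [Matrix.mul_assoc]
      _ = _ := by rw [← Matrix.sum_mul, ← Matrix.mul_sum, hc, Matrix.mul_one]
  have hQk : ∀ i k Z, ((y (i + k))ᴴ * y (i + k) * (transfer A ^ k) Z).trace =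
      ((y i)ᴴ * y i * Z).trace := by
    intro i k
    induction k with
    | zero => simp
    | succ k ih =>
      intro Z
      rw [pow_succ', Module.End.mul_apply, trace_mul_transfer, ← Nat.add_assoc, hQ, ih]
  have hμμ : star μ * μ = 1 := by
    rw [RCLike.star_def, mul_comm, Complex.mul_conj, Complex.normSq_eq_norm_sq, hμ]
    norm_num
  have hQL : ∀ i m, (y (i + m * L))ᴴ * y (i + m * L) = (y i)ᴴ * y i := by
    intro i m
    induction m with
    | zero => rw [Nat.zero_mul, Nat.add_zero]
    | succ m ih =>
      rw [Nat.succ_mul, ← Nat.add_assoc, hyL, Matrix.conjTranspose_smul, Matrix.smul_mul,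
        Matrix.mul_smul, smul_smul, hμμ, one_smul, ih]
  have hQc : ∀ i, ∃ c : ℂ, (y i)ᴴ * y i = c • 1 := fun i =>
    hG.eq_smul_one_of_trace fun m Z => by rw [← hQk i (m * L) Z, hQL]
  choose c hc using hQc
  have hcs : ∀ i, c i = c 0 := by
    intro i
    induction i with
    | zero => rfl
    | succ i ih =>
      rw [← ih]
      have h1 := hQ i
      have h2 : transferLeft A 1 = 1 := by simpa using hG.left
      rw [hc, hc, map_smul, h2] at h1
      exact smul_left_injective ℂ one_ne_zero h1
  obtain ⟨t, ht, ht0, -⟩ := exists_unitary_of_conjTranspose_mul_self (hy0 0) (hc 0)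
  have hw : ∀ i, (((Real.sqrt t : ℝ) : ℂ)⁻¹ • y i) ∈ Matrix.unitaryGroup (Fin χ) ℂ := by
    intro i
    obtain ⟨t', ht', -, hu⟩ := exists_unitary_of_conjTranspose_mul_self (hy0 i) (hc i)
    have : t' = t := by
      rw [hcs, ht] at ht'
      exact_mod_cast ht'.symm
    rwa [this] at hu
  refine ⟨fun i => ⟨_, hw i⟩, fun i => ⟨μ, hμ, ?_⟩, fun i s => ?_⟩
  · simp only [hyL, smul_comm μ]
  · simp only [Matrix.mul_smul, Matrix.smul_mul, hy]

/-- The fundamental theorem: on-site symmetries of an injective left-canonical tensor push through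
to unitaries on the bonds, which are periodic up to phases. -/
theorem IsSymmetric.exists_pushesThrough {L : ℕ} [NeZero L] {U : ℤ → Unitary d}
    {A : Tensor d χ} (hU : Function.Periodic U (L : ℤ)) (h : IsSymmetric L U A)
    (hL : IsLeftCanonical A) (hA : IsInjective A) :
    ∃ v : ℤ → Unitary χ, PushesThrough A U v ∧ ∀ j, v (j + L) = v j := by
  obtain ⟨w, hwL, hw⟩ := h.exists_unitary_intertwiner hU hL hA
  have hL0 : (L : ℤ) ≠ 0 := by exact_mod_cast NeZero.ne L
  have hwmod : ∀ i, EqPhase (w i).1 (w (i % L)).1 := by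
    intro i
    have : ∀ m r, EqPhase (w (r + m * L)).1 (w r).1 := by
      intro m r
      induction m with
      | zero => simpa using EqPhase.refl (w r).1
      | succ m ih =>
        rw [Nat.succ_mul, ← Nat.add_assoc]
        exact (hwL _).trans ih
    have h1 := this (i / L) (i % L)
    rwa [Nat.mod_add_div'] at h1
  -- The intertwiners are indexed downwards by naturals, so bond `j` uses the residue of `-j` modulo
  -- `L`. Choosing residues makes the family exactly periodic; a phase enters only through `hwmod`,
  -- where the index wraps around.
  let p : ℤ → ℕ := fun j => (-j % (L : ℤ)).toNat
  have hp : ∀ j, (p j : ℤ) = -j % (L : ℤ) := fun j => Int.toNat_of_nonneg (Int.emod_nonneg _ hL0)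
  have hpp : ∀ j, p (j - 1) = (p j + 1) % L := by
    intro j
    have h1 : ((p (j - 1) : ℕ) : ℤ) = (((p j + 1) % L : ℕ) : ℤ) := by
      push_cast
      rw [hp, hp, Int.emod_add_emod]
      congr 1
      ring
    exact_mod_cast h1
  have hUp : ∀ j, U (-(p j : ℤ)) = U j := by
    intro j
    have h1 : -(p j : ℤ) = j + (-j / (L : ℤ)) * L := by
      rw [hp, Int.emod_def]
      ring
    rw [h1]
    exact hU.int_mul _ j
  refine ⟨fun j => (w (p j))⁻¹, fun j => ?_, fun j => ?_⟩
  · obtain ⟨z, hz, e⟩ := hwmod (p j + 1)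
    refine ⟨z, hz, ?_⟩
    funext s
    simp only [Pi.smul_apply, Matrix.UnitaryGroup.inv_val, Matrix.star_eq_conjTranspose,
      Matrix.conjTranspose_conjTranspose]
    rw [hpp, ← Matrix.smul_mul, ← Matrix.smul_mul, ← e, ← hw, hUp, Matrix.mul_assoc,
      Unitary.mul_conjTranspose, Matrix.mul_one]
  · have : p (j + L) = p j := by
      have h1 : (p (j + L) : ℤ) = p j := by
        rw [hp, hp, neg_add, ← sub_eq_add_neg, Int.sub_emod_right]
      exact_mod_cast h1
    simp only [this]

/-- For site-independent operators the bond unitary can be chosen site-independent. -/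
theorem PushesThrough.const {U : Unitary d} {A : Tensor d χ} {v : ℤ → Unitary χ}
    (hA : IsInjective A) (h : PushesThrough A (fun _ => U) v) :
    PushesThrough A (fun _ => U) (fun _ => v 0) := by
  intro j
  -- The family shifted by one bond pushes through the same constant operators, so `v (-1) ≐ v 0`.
  obtain ⟨z, hz, e⟩ := PushesThrough.eqPhase hA (h.shift (-1)) h 0
  refine (h 0).trans ⟨star z, by simpa using hz, ?_⟩
  funext s
  simp only [Pi.smul_apply]
  rw [show (0 : ℤ) - 1 = 0 + -1 by ring, e, Matrix.conjTranspose_smul, Matrix.smul_mul,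
    Matrix.smul_mul]

end

/-! ### Reduction to the left-canonical gauge -/

section Gauge

variable {d χ : ℕ}

/-- The tensor rescaled by `g` and conjugated by `S`. -/
noncomputable def gauge (g : ℂ) (S : Matrix (Fin χ) (Fin χ) ℂ) (A : Tensor d χ) : Tensor d χ :=
  fun s => g • (S * A s * S⁻¹)

theorem prod_ofFn_conj {S : Matrix (Fin χ) (Fin χ) ℂ} (hS : IsUnit S.det) :
    ∀ {M : ℕ} (f : Fin M → Matrix (Fin χ) (Fin χ) ℂ),
      (List.ofFn fun i => S * f i * S⁻¹).prod = S * (List.ofFn f).prod * S⁻¹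
  | 0, f => by simp [Matrix.mul_nonsing_inv _ hS]
  | M + 1, f => by
    rw [List.ofFn_succ, List.prod_cons, prod_ofFn_conj hS, List.ofFn_succ, List.prod_cons]
    simp only [Matrix.mul_assoc, Matrix.nonsing_inv_mul_cancel_left _ _ hS]

theorem state_gauge {S : Matrix (Fin χ) (Fin χ) ℂ} (hS : IsUnit S.det) (g : ℂ) (A : Tensor d χ)
    (M : ℕ) : state (gauge g S A) M = g ^ M • state A M := by
  funext s
  simp only [state, gauge, prod_ofFn_smul, prod_ofFn_conj hS, Pi.smul_apply, Finset.prod_const,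
    Finset.card_univ, Fintype.card_fin, Matrix.trace_smul]
  rw [Matrix.trace_mul_comm, Matrix.nonsing_inv_mul_cancel_left _ _ hS]

theorem IsSymmetric.gauge {S : Matrix (Fin χ) (Fin χ) ℂ} (hS : IsUnit S.det) (g : ℂ)
    {A : Tensor d χ} {L : ℕ} {U : ℤ → Unitary d} (h : IsSymmetric L U A) :
    IsSymmetric L U (gauge g S A) := by
  intro k hk
  obtain ⟨z, hz, e⟩ := h k hk
  exact ⟨z, hz, by rw [state_gauge hS, Matrix.mulVec_smul, e, smul_comm]⟩

/-- The congruence `X ↦ S X S†` conjugates one transfer matrix into the other up to the factor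
`|g|²`, so the spectral conditions of injectivity carry over. -/
theorem transfer_gauge {S : Matrix (Fin χ) (Fin χ) ℂ} (hS : IsUnit S.det) (g : ℂ) (A : Tensor d χ)
    (X : Matrix (Fin χ) (Fin χ) ℂ) :
    transfer (gauge g S A) (S * X * Sᴴ) = (g * star g) • (S * transfer A X * Sᴴ) := by
  have hS' : IsUnit Sᴴ.det := by
    rw [Matrix.det_conjTranspose]
    exact hS.star
  simp only [transfer_apply, gauge, Matrix.mul_sum, Matrix.sum_mul, Finset.smul_sum]
  refine Finset.sum_congr rfl fun s _ => ?_
  simp only [Matrix.conjTranspose_smul, Matrix.conjTranspose_mul, Matrix.smul_mul, Matrix.mul_smul,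
    smul_smul, Matrix.mul_assoc, Matrix.nonsing_inv_mul_cancel_left _ _ hS]
  rw [Matrix.conjTranspose_nonsing_inv, Matrix.mul_nonsing_inv_cancel_left _ _ hS', mul_comm]

/-- Every injective tensor has a left-canonical injective gauge. -/
theorem IsInjective.exists_gauge {A : Tensor d χ} (hA : IsInjective A) :
    ∃ (g : ℂ) (S : Matrix (Fin χ) (Fin χ) ℂ), IsUnit S.det ∧ IsInjective (gauge g S A) ∧
      IsLeftCanonical (gauge g S A) := by
  have := hA.neZero
  obtain ⟨r, ρ, Λ, hr, hρ, hΛ, eρ, eΛ, hg⟩ := hA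
  obtain ⟨S, hSu, rfl⟩ := hΛ.exists_eq_conjTranspose_mul_self
  have hS : IsUnit S.det := (Matrix.isUnit_iff_isUnit_det S).1 hSu
  have hS' : IsUnit Sᴴ.det := by
    rw [Matrix.det_conjTranspose]
    exact hS.star
  have hrc : (r : ℂ) ≠ 0 := by exact_mod_cast hr.ne'
  -- With `Λ = S† S`, conjugation by `S` turns the left eigenvector into `1`, and `g = r ^ (-1/2)`
  -- turns its eigenvalue into `1`.
  set g : ℂ := ((Real.sqrt r : ℝ) : ℂ)⁻¹ with hgdef
  have hgg : g * star g = (r : ℂ)⁻¹ := by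
    rw [hgdef, star_inv₀, RCLike.star_def, Complex.conj_ofReal, ← mul_inv, ← Complex.ofReal_mul,
      Real.mul_self_sqrt hr.le]
  have hL : IsLeftCanonical (gauge g S A) := by
    have e := eΛ.apply_eq_smul
    rw [transferLeft_apply] at e
    unfold IsLeftCanonical
    calc ∑ s, (gauge g S A s)ᴴ * gauge g S A s
        = (g * star g) • ((Sᴴ)⁻¹ * (∑ s, (A s)ᴴ * (Sᴴ * S) * A s) * S⁻¹) := by
          simp only [gauge, Matrix.mul_sum, Matrix.sum_mul, Finset.smul_sum]
          refine Finset.sum_congr rfl fun s _ => ?_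
          simp only [Matrix.conjTranspose_smul, Matrix.conjTranspose_mul, Matrix.smul_mul,
            Matrix.mul_smul, smul_smul, Matrix.mul_assoc, Matrix.conjTranspose_nonsing_inv]
      _ = 1 := by
          rw [e, hgg, Matrix.mul_smul, Matrix.smul_mul, inv_smul_smul₀ hrc,
            Matrix.nonsing_inv_mul_cancel_left _ _ hS', Matrix.mul_nonsing_inv _ hS]
  refine ⟨g, S, hS, ⟨1, S * ρ * Sᴴ, 1, one_pos, ?_, Matrix.PosDef.one, ?_, ?_, ?_⟩, hL⟩
  · exact hρ.mul_mul_conjTranspose_same (Matrix.vecMul_injective_of_isUnit hSu)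
  · refine Module.End.hasEigenvector_iff.2 ⟨Module.End.mem_eigenspace_iff.2 ?_, ?_⟩
    · rw [transfer_gauge hS, eρ.apply_eq_smul, hgg, Matrix.mul_smul, Matrix.smul_mul,
        inv_smul_smul₀ hrc, Complex.ofReal_one, one_smul]
    · exact (hρ.mul_mul_conjTranspose_same (Matrix.vecMul_injective_of_isUnit hSu)).isUnit.ne_zero
  · refine Module.End.hasEigenvector_iff.2 ⟨Module.End.mem_eigenspace_iff.2 ?_, one_ne_zero⟩
    unfold IsLeftCanonical at hL
    rw [transferLeft_apply, Complex.ofReal_one, one_smul]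
    simpa only [Matrix.mul_one] using hL
  · intro μ Y hY hμ
    obtain ⟨X, rfl⟩ : ∃ X, Y = S * X * Sᴴ := ⟨S⁻¹ * Y * (Sᴴ)⁻¹, by
      rw [Matrix.mul_assoc S⁻¹, Matrix.mul_nonsing_inv_cancel_left _ _ hS,
        Matrix.nonsing_inv_mul_cancel_right _ _ hS']⟩
    have e := hY.apply_eq_smul
    rw [transfer_gauge hS, hgg, inv_smul_eq_iff₀ hrc, smul_smul] at e
    have e' : transfer A X = ((r : ℂ) * μ) • X := by
      refine hSu.mul_left_cancel (((Matrix.isUnit_conjTranspose S).2 hSu).mul_right_cancel ?_)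
      rw [e, Matrix.mul_smul, Matrix.smul_mul]
    have hX : X ≠ 0 := by
      rintro rfl
      exact hY.2 (by rw [Matrix.mul_zero, Matrix.zero_mul])
    obtain ⟨h1, c, rfl⟩ := hg _ X (Module.End.hasEigenvector_iff.2
      ⟨Module.End.mem_eigenspace_iff.2 e', hX⟩) (by
        rw [norm_mul, Complex.norm_real, Real.norm_of_nonneg hr.le]
        exact le_mul_of_one_le_right hr.le hμ)
    refine ⟨?_, c, by rw [Matrix.mul_smul, Matrix.smul_mul]⟩
    rw [Complex.ofReal_one]
    exact mul_left_cancel₀ hrc (by rw [h1, mul_one])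

end Gauge

/-! ### The Lieb–Schultz–Mattis constraint -/

section Symmetry

variable {d χ N L : ℕ} [NeZero L] {Uq Ud : ℤ → Unitary d}

theorem IsDipoleSymmetry.exists_pushesThrough {A : Tensor d χ} (hU : IsDipoleSymmetry N L Uq Ud)
    (hA : IsInjective A) (hL : IsLeftCanonical A) (hq : IsSymmetric L Uq A)
    (hd : IsSymmetric L Ud A) :
    ∃ (vq : Unitary χ) (vd : ℤ → Unitary χ), PushesThrough A Uq (fun _ => vq) ∧
      PushesThrough A Ud vd ∧ ∀ j : ℤ, vd (j + L) = vd j := by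
  obtain ⟨vq, hvq, -⟩ := hq.exists_pushesThrough hU.periodic_q hL hA
  obtain ⟨vd, hvd, hper⟩ := hd.exists_pushesThrough hU.periodic_d hL hA
  have hc : Uq = fun _ => Uq 0 := by
    have h1 : Function.Periodic Uq 1 := fun j => by
      rw [hU.translate_q (j + 1), add_sub_cancel_right]
    funext j
    simpa using h1.int_mul_eq j
  rw [hc] at hvq ⊢
  exact ⟨vq 0, vd, hvq.const hA, hvd, hper⟩

/-- The Lieb–Schultz–Mattis constraint. -/
theorem IsDipoleSymmetry.not_hasSymmetricInjectiveMPS [NeZero N] {n : ℤ}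
    (hU : IsDipoleSymmetry N L Uq Ud) (hn : OnSiteProjective N n Uq Ud) (hnN : ¬ (N : ℤ) ∣ n) :
    ¬ HasSymmetricInjectiveMPS L Uq Ud := by
  rintro ⟨χ, A, hA, hq, hd⟩
  obtain ⟨g, S, hS, hA', hL'⟩ := hA.exists_gauge
  have := hA.neZero
  obtain ⟨vq, vd, hvq, hvd, -⟩ := hU.exists_pushesThrough hA' hL' (hq.gauge hS g) (hd.gauge hS g)
  obtain ⟨k, hk, hkn⟩ := exists_bondInvariant_eq_rootPhase hU.zn_q hn hA' hvq hvd
  -- The dipole algebra equates the invariants of bonds `0` and `1`, whereas `hkn` makes their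
  -- exponents differ by `n` modulo `N`.
  have h1 := bondInvariant_eq_of_eqPhase (hU.eqPhase_bond hA' hvq hvd 1)
  have h2 := congrArg Subtype.val h1
  rw [hk, hk] at h2
  have h3 := (rootPhase_eq_iff N _ _).1 (smul_left_injective ℂ one_ne_zero h2)
  have h4 := (h3.symm.trans (hkn 1)).dvd
  rw [add_sub_cancel_left] at h4
  exact hnN h4

end Symmetry

/-! ### The clock and shift example -/

section ClockShift

/-- Conjugation by `x` sends `z` to `c z`, and `c` is central, so `m`-th powers can be taken. -/
theorem zpow_mul_eq_of_mul_eq {G : Type*} [Group G] {x z c : G} (hc : ∀ g, Commute c g)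
    (h : z * x = c * (x * z)) (m : ℤ) : z ^ m * x = c ^ m * (x * z ^ m) := by
  have h1 : x⁻¹ * z * x = c * z := by
    rw [mul_assoc, h, ← mul_assoc, ← (hc x⁻¹).eq, mul_assoc, inv_mul_cancel_left]
  have h2 := conj_zpow (i := m) (a := x⁻¹) (b := z)
  rw [inv_inv, h1, (hc z).mul_zpow] at h2
  calc z ^ m * x = x * (x⁻¹ * z ^ m * x) := by group
    _ = c ^ m * (x * z ^ m) := by
      rw [← h2, ← mul_assoc, ← ((hc x).zpow_left m).eq, mul_assoc]

/-- The exponent of `c` is left unspecified because the application needs the power only up to a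
phase. -/
theorem exists_mul_pow_eq {G : Type*} [Group G] {x z c : G} (hc : ∀ g, Commute c g)
    (h : z * x = c * (x * z)) (m : ℕ) : ∃ e : ℤ, (x * z) ^ m = c ^ e * (x ^ m * z ^ m) := by
  induction m with
  | zero => exact ⟨0, by simp⟩
  | succ m ih =>
    obtain ⟨e, he⟩ := ih
    have h1 := zpow_mul_eq_of_mul_eq hc h m
    rw [zpow_natCast, zpow_natCast] at h1
    refine ⟨e + m, ?_⟩
    have hcm : c ^ m * x ^ m = x ^ m * c ^ m := ((hc (x ^ m)).pow_left m).eq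
    calc (x * z) ^ (m + 1) = c ^ e * (x ^ m * (z ^ m * x) * z) := by
          rw [pow_succ, he]
          simp only [mul_assoc]
      _ = c ^ e * ((x ^ m * c ^ m) * x * z ^ m * z) := by
          rw [h1]
          simp only [mul_assoc]
      _ = c ^ (e + m) * (x ^ (m + 1) * z ^ (m + 1)) := by
          rw [← hcm, _root_.zpow_add, zpow_natCast, pow_succ x, pow_succ z]
          simp only [mul_assoc]

variable (N : ℕ)

theorem smul_one_mem_unitaryGroup {z : ℂ} (hz : ‖z‖ = 1) :
    z • (1 : Matrix (Fin N) (Fin N) ℂ) ∈ Matrix.unitaryGroup (Fin N) ℂ := by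
  rw [Matrix.mem_unitaryGroup_iff, Matrix.star_eq_conjTranspose, Matrix.conjTranspose_smul,
    Matrix.conjTranspose_one, Matrix.smul_mul, Matrix.one_mul, smul_smul, RCLike.star_def,
    Complex.mul_conj, Complex.normSq_eq_norm_sq, hz]
  simp

/-- The scalar unitaries `exp (2 π i k / N)`, as a homomorphism. -/
noncomputable def phaseUnitary : Multiplicative ℤ →* Unitary N where
  toFun k := ⟨rootPhase N k.toAdd • 1, smul_one_mem_unitaryGroup N (norm_rootPhase N _)⟩
  map_one' := by
    apply Subtype.ext
    simp [rootPhase]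
  map_mul' k l := by
    apply Subtype.ext
    simp [rootPhase_add, smul_smul, mul_comm]

theorem phaseUnitary_val (k : ℤ) :
    (phaseUnitary N (Multiplicative.ofAdd k) : Matrix (Fin N) (Fin N) ℂ) = rootPhase N k • 1 := rfl

theorem phaseUnitary_zpow (k m : ℤ) : phaseUnitary N (Multiplicative.ofAdd k) ^ m =
    phaseUnitary N (Multiplicative.ofAdd (k * m)) := by
  rw [← map_zpow, ← ofAdd_zsmul, smul_eq_mul, mul_comm]

theorem phaseUnitary_commute (k : ℤ) (w : Unitary N) :
    Commute (phaseUnitary N (Multiplicative.ofAdd k)) w := by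
  apply Subtype.ext
  simp only [Submonoid.coe_mul, phaseUnitary_val, Matrix.smul_mul, Matrix.mul_smul, Matrix.one_mul,
    Matrix.mul_one]

variable [NeZero N]

theorem clock_mul_shift :
    clock N * shift N = phaseUnitary N (Multiplicative.ofAdd 1) * (shift N * clock N) := by
  apply Subtype.ext
  simp only [Submonoid.coe_mul, phaseUnitary_val, Matrix.smul_mul, Matrix.one_mul]
  ext s t
  simp only [clock, shift, Matrix.diagonal_mul, Matrix.smul_apply, Matrix.mul_diagonal,
    Matrix.of_apply]
  by_cases h : s = t + 1
  · rw [if_pos h, mul_one, one_mul, smul_eq_mul, ← rootPhase_add, rootPhase_eq_iff, h, Fin.val_add]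
    push_cast
    refine (Int.mod_modEq _ _).trans ?_
    rw [add_comm (1 : ℤ)]
    refine Int.ModEq.add_left _ ?_
    rw [Fin.val_one']
    push_cast
    exact Int.mod_modEq _ _
  · simp [if_neg h]

theorem shift_pow_apply (k : ℕ) (s t : Fin N) :
    ((shift N).1 ^ k) s t = if s = t + k • 1 then 1 else 0 := by
  induction k generalizing t with
  | zero => simp [Matrix.one_apply]
  | succ k ih =>
    rw [pow_succ, Matrix.mul_apply, Finset.sum_eq_single (t + 1)]
    · rw [ih, succ_nsmul', ← add_assoc]
      simp [shift]
    · intro u _ hu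
      simp [shift, hu]
    · simp

theorem shift_pow_self : shift N ^ N = 1 := by
  apply Subtype.ext
  ext s t
  rw [show ((shift N ^ N : Unitary N) : Matrix (Fin N) (Fin N) ℂ) = (shift N).1 ^ N from rfl,
    shift_pow_apply]
  have h : N • (1 : Fin N) = 0 := by
    simpa using card_nsmul_eq_zero' (x := (1 : Fin N))
  rw [h, add_zero]
  rfl

theorem clock_pow_self : clock N ^ N = 1 := by
  apply Subtype.ext
  rw [show ((clock N ^ N : Unitary N) : Matrix (Fin N) (Fin N) ℂ) = (clock N).1 ^ N from rfl]
  simp only [clock, Matrix.diagonal_pow]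
  rw [show ((1 : Unitary N) : Matrix (Fin N) (Fin N) ℂ) = 1 from rfl, ← Matrix.diagonal_one]
  congr 1
  funext s
  have : (N : ℂ) ≠ 0 := NeZero.ne _
  rw [Pi.pow_apply, rootPhase, ← Complex.exp_nat_mul, Complex.exp_eq_one_iff]
  exact ⟨(s : ℕ), by push_cast; field_simp⟩

theorem clock_zpow_mul_shift_zpow (m j : ℤ) : clock N ^ m * shift N ^ j =
    phaseUnitary N (Multiplicative.ofAdd (m * j)) * (shift N ^ j * clock N ^ m) := by
  have h1 := zpow_mul_eq_of_mul_eq (phaseUnitary_commute N 1) (clock_mul_shift N) m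
  rw [phaseUnitary_zpow, one_mul] at h1
  have h2 : shift N * clock N ^ m =
      phaseUnitary N (Multiplicative.ofAdd (-m)) * (clock N ^ m * shift N) := by
    rw [h1, ofAdd_neg, map_inv, inv_mul_cancel_left]
  have h3 := zpow_mul_eq_of_mul_eq (phaseUnitary_commute N (-m)) h2 j
  rw [phaseUnitary_zpow] at h3
  rw [h3, ← mul_assoc, ← map_mul, ← ofAdd_add, show m * j + -m * j = 0 by ring, ofAdd_zero, map_one,
    one_mul]

theorem isDipoleSymmetry_clock_shift {L : ℕ} (n : ℤ) (hNL : N ∣ L) :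
    IsDipoleSymmetry N L (fun _ => shift N) (fun j => clock N ^ (-n) * shift N ^ j) where
  periodic_q _ := rfl
  periodic_d j := by
    obtain ⟨m, rfl⟩ := hNL
    have : shift N ^ ((N * m : ℕ) : ℤ) = 1 := by
      rw [zpow_natCast, pow_mul, shift_pow_self, one_pow]
    simp only [_root_.zpow_add, this, mul_one]
  zn_q _ := by
    have h := congrArg Subtype.val (shift_pow_self N)
    exact ⟨1, norm_one, by rw [one_smul]; exact h⟩
  zn_d j := by
    -- The two factors of `U_{d,j}` commute up to a central phase, so the `N`-th power splits, up to
    -- a phase, into powers of `Z ^ N = 1` and `X ^ N = 1`.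
    have h1 : shift N ^ j * clock N ^ (-n) = phaseUnitary N (Multiplicative.ofAdd (n * j)) *
        (clock N ^ (-n) * shift N ^ j) := by
      rw [clock_zpow_mul_shift_zpow, ← mul_assoc, ← map_mul, ← ofAdd_add,
        show n * j + -n * j = 0 by ring, ofAdd_zero, map_one, one_mul]
    obtain ⟨e, he⟩ := exists_mul_pow_eq (phaseUnitary_commute N _) h1 N
    rw [← zpow_natCast (clock N ^ (-n)), ← zpow_natCast (shift N ^ j), zpow_comm, zpow_comm _ j,
      zpow_natCast, zpow_natCast, clock_pow_self, shift_pow_self, _root_.one_zpow, _root_.one_zpow, mul_one,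
      mul_one, phaseUnitary_zpow] at he
    exact ⟨_, norm_rootPhase N _, congrArg Subtype.val he⟩
  translate_q _ := rfl
  translate_d j := by
    rw [mul_assoc, ← _root_.zpow_add_one, sub_add_cancel]

theorem onSiteProjective_clock_shift (n : ℤ) :
    OnSiteProjective N n (fun _ => shift N) (fun j => clock N ^ (-n) * shift N ^ j) := by
  intro j
  have h : shift N * (clock N ^ (-n) * shift N ^ j) = phaseUnitary N (Multiplicative.ofAdd n) *
      ((clock N ^ (-n) * shift N ^ j) * shift N) := by
    have h1 := clock_zpow_mul_shift_zpow N (-n) 1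
    rw [zpow_one, mul_one] at h1
    rw [mul_assoc, ← (Commute.self_zpow (shift N) j).eq, ← mul_assoc (clock N ^ (-n)), h1,
      ← mul_assoc, ← mul_assoc, ← mul_assoc, ← map_mul, ← ofAdd_add, add_neg_cancel, ofAdd_zero,
      map_one, one_mul]
  have h2 := congrArg Subtype.val h
  simpa only [Submonoid.coe_mul, phaseUnitary_val, Matrix.smul_mul, Matrix.one_mul] using h2

end ClockShift

end DipoleLSM

theorem mainTheorem8 (N L : ℕ) [NeZero N] [NeZero L] (n : ℤ) :
    -- a symmetric injective MPS has unitary push-through data, with a site-independent `v_q`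
    (∀ (d χ : ℕ) (Uq Ud : ℤ → DipoleLSM.Unitary d) (A : DipoleLSM.Tensor d χ),
      DipoleLSM.IsDipoleSymmetry N L Uq Ud →
      DipoleLSM.IsInjective A → DipoleLSM.IsLeftCanonical A →
      DipoleLSM.IsSymmetric L Uq A → DipoleLSM.IsSymmetric L Ud A →
      ∃ (vq : DipoleLSM.Unitary χ) (vd : ℤ → DipoleLSM.Unitary χ),
        DipoleLSM.PushesThrough A Uq (fun _ => vq) ∧ DipoleLSM.PushesThrough A Ud vd ∧
        ∀ j : ℤ, DipoleLSM.EqPhase (vd (j + L) : Matrix (Fin χ) (Fin χ) ℂ)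
          (vd j : Matrix (Fin χ) (Fin χ) ℂ)) ∧
    -- the dipole algebra forces the bond invariant to be site-independent
    (∀ (d χ : ℕ) (Uq Ud : ℤ → DipoleLSM.Unitary d) (A : DipoleLSM.Tensor d χ)
      (vq : DipoleLSM.Unitary χ) (vd : ℤ → DipoleLSM.Unitary χ),
      DipoleLSM.IsDipoleSymmetry N L Uq Ud → DipoleLSM.IsInjective A →
      DipoleLSM.PushesThrough A Uq (fun _ => vq) → DipoleLSM.PushesThrough A Ud vd →
      (∀ j : ℤ, DipoleLSM.EqPhase (vd j : Matrix (Fin χ) (Fin χ) ℂ)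
        ((vd (j - 1) : Matrix (Fin χ) (Fin χ) ℂ) * (vq : Matrix (Fin χ) (Fin χ) ℂ))) ∧
      ∀ j : ℤ, DipoleLSM.bondInvariant vq (vd j) = DipoleLSM.bondInvariant vq (vd (j - 1))) ∧
    -- the on-site projective relation makes the bond invariant an `N`-th root of unity that
    -- changes by `exp (2 π i n / N)` from each bond to the next
    (∀ (d χ : ℕ) (Uq Ud : ℤ → DipoleLSM.Unitary d) (A : DipoleLSM.Tensor d χ)
      (vq : DipoleLSM.Unitary χ) (vd : ℤ → DipoleLSM.Unitary χ),
      DipoleLSM.IsZN N Uq → DipoleLSM.IsZN N Ud → DipoleLSM.OnSiteProjective N n Uq Ud →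
      DipoleLSM.IsInjective A →
      DipoleLSM.PushesThrough A Uq (fun _ => vq) → DipoleLSM.PushesThrough A Ud vd →
      ∃ k : ℤ → ℤ,
        (∀ j : ℤ, (DipoleLSM.bondInvariant vq (vd j) : Matrix (Fin χ) (Fin χ) ℂ) =
          DipoleLSM.rootPhase N (k j) • 1) ∧
        ∀ j : ℤ, k j ≡ k (j - 1) + n [ZMOD N]) ∧
    -- the LSM constraint
    (∀ (d : ℕ) (Uq Ud : ℤ → DipoleLSM.Unitary d),
      DipoleLSM.IsDipoleSymmetry N L Uq Ud → DipoleLSM.OnSiteProjective N n Uq Ud →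
      ¬ (N : ℤ) ∣ n → ¬ DipoleLSM.HasSymmetricInjectiveMPS L Uq Ud) ∧
    -- the qudit chain with `U_q = ⨂ X_j` and `U_d = ⨂ Z_j^{-n} X_j^j`
    (N ∣ L →
      DipoleLSM.IsDipoleSymmetry N L (fun _ => DipoleLSM.shift N)
        (fun j => DipoleLSM.clock N ^ (-n) * DipoleLSM.shift N ^ j) ∧
      DipoleLSM.OnSiteProjective N n (fun _ => DipoleLSM.shift N)
        (fun j => DipoleLSM.clock N ^ (-n) * DipoleLSM.shift N ^ j) ∧
      (¬ (N : ℤ) ∣ n →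
        ¬ DipoleLSM.HasSymmetricInjectiveMPS L (fun _ => DipoleLSM.shift N)
          (fun j => DipoleLSM.clock N ^ (-n) * DipoleLSM.shift N ^ j))) := by
  refine ⟨fun d χ Uq Ud A hU hA hL hq hd => ?_, fun d χ Uq Ud A vq vd hU hA hq hd => ⟨fun j =>
    hU.eqPhase_bond hA hq hd j, fun j =>
    DipoleLSM.bondInvariant_eq_of_eqPhase (hU.eqPhase_bond hA hq hd j)⟩,
    fun d χ Uq Ud A vq vd hZ _ hU hA hq hd =>
      DipoleLSM.exists_bondInvariant_eq_rootPhase hZ hU hA hq hd,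
    fun d Uq Ud hU hn hnN => hU.not_hasSymmetricInjectiveMPS hn hnN, fun hNL => ?_⟩
  · obtain ⟨vq, vd, h1, h2, h3⟩ := hU.exists_pushesThrough hA hL hq hd
    exact ⟨vq, vd, h1, h2, fun j => by rw [h3]; exact DipoleLSM.EqPhase.refl _⟩
  · have hU := DipoleLSM.isDipoleSymmetry_clock_shift N n hNL
    have hn := DipoleLSM.onSiteProjective_clock_shift N n
    exact ⟨hU, hn, hU.not_hasSymmetricInjectiveMPS hn⟩
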